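/- Let $\mathbb K=\mathbb Q(r,s)$ be the field of rational functions in two indeterminates $r,s$, and let $n>2$. Put $I_0=\{0,1,\dots,n-1\}$ and $I=\{1,\dots,n-1\}$. Let $\varepsilon_1,\dots,\varepsilon_n$ be orthonormal vectors, orthogonal to an isotropic vector $\delta$, and put $\alpha_i=\varepsilon_i-\varepsilon_{i+1}$ for $i\in I$, $\alpha_0=\delta-(\varepsilon_1-\varepsilon_n)$, and $a_{ij}=(\alpha_i,\alpha_j)$. Put $$c_{ji}(r,s)=r^{(\varepsilon_j,\alpha_i)}s^{(\varepsilon_{j+1},\alpha_i)}\ (j\in I,\ i\in I_0),\qquad c_{0i}(r,s)=r^{-(\varepsilon_{i+1},\alpha_0)}s^{(\varepsilon_1,\alpha_i)}\ (i\in I_0).$$ Let $U_{r,s}(\widehat{\mathfrak{sl}_n})$ be the unital associative $\mathbb K$-algebra generated by $e_j,\ f_j,\ \omega_j^{\pm1},\ \omega_j'^{\pm1}$ $(j\in I_0)$, $\gamma^{\pm\frac12},\ \gamma'^{\pm\frac12},\ D^{\pm1},\ D'^{\pm1}$ with the following defining relations, where $i,j$ run over $I_0$ and in (A6), (A7) the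 index $i+1$ is read modulo $n$. - (A1) The $\omega_j,\omega'_j,\gamma^{\frac12},\gamma'^{\frac12},D,D'$ are invertible with the indicated inverses and commute with each other; $\gamma^{\pm\frac12},\gamma'^{\pm\frac12}$ are central; and, with $\gamma=(\gamma^{\frac12})^2$ and $\gamma'=(\gamma'^{\frac12})^2$, one has $\gamma=\omega_0\omega_1\cdots\omega_{n-1}$, $\gamma'=\omega'_0\omega'_1\cdots\omega'_{n-1}$, $\gamma\gamma'=rs$. - (A2) $De_iD^{-1}=r^{\delta_{0i}}e_i$, $Df_iD^{-1}=r^{-\delta_{0i}}f_i$, $\omega_je_i\omega_j^{-1}=c_{ji}(r,s)\,e_i$, $\omega_jf_i\omega_j^{-1}=c_{ji}(r,s)^{-1}f_i$. - (A3) $D'e_iD'^{-1}=s^{\delta_{0i}}e_i$, $D'f_iD'^{-1}=s^{-\delta_{0i}}f_i$, $\omega'_je_i\omega_j'^{-1}=c_{ji}(s,r)\,e_i$, $\omega'_jf_i\omega_j'^{-1}=c_{ji}(s,r)^{-1}f_i$. - (A4) $e_if_j-f_je_i=\dfrac{\delta_{ij}}{r-s}(\omega_i-\omega'_i)$. - (A5)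 $e_ie_j=e_je_i$ and $f_if_j=f_jf_i$ whenever $a_{ij}=0$. - (A6) $e_i^2e_{i+1}-(r+s)e_ie_{i+1}e_i+rs\,e_{i+1}e_i^2=0$ and $e_ie_{i+1}^2-(r+s)e_{i+1}e_ie_{i+1}+rs\,e_{i+1}^2e_i=0$. - (A7) $f_i^2f_{i+1}-(r^{-1}+s^{-1})f_if_{i+1}f_i+r^{-1}s^{-1}f_{i+1}f_i^2=0$ and $f_if_{i+1}^2-(r^{-1}+s^{-1})f_{i+1}f_if_{i+1}+r^{-1}s^{-1}f_{i+1}^2f_i=0$. Let $U_{r,s}(\widehat{\mathfrak n})$, $U_{r,s}(\widehat{\mathfrak n}^-)$ and $U^0$ be the subalgebras of $U_{r,s}(\widehat{\mathfrak{sl}_n})$ generated respectively by the $e_i$ $(i\in I_0)$, by the $f_i$ $(i\in I_0)$, and by $\omega_i^{\pm1},\omega_i'^{\pm1}$ $(i\in I_0)$, $\gamma^{\pm\frac12},\gamma'^{\pm\frac12},D^{\pm1},D'^{\pm1}$. **Corollary 2.7 (triangular decomposition).** Multiplication $x\otimes y\otimes z\mapsto xyz$ is an isomorphism of $\mathbb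 K$-vector spaces $$U_{r,s}(\widehat{\mathfrak n}^-)\otimes_{\mathbb K}U^0\otimes_{\mathbb K}U_{r,s}(\widehat{\mathfrak n})\;\cong\;U_{r,s}(\widehat{\mathfrak{sl}_n}).$$ -/

import Mathlib

open scoped TensorProduct

namespace TwoParamAffine

/-- The field `ℚ(r, s)` of rational functions in two indeterminates. -/
abbrev QRS : Type := FractionRing (MvPolynomial (Fin 2) ℚ)

/-- The indeterminate `r` of `ℚ(r, s)`. -/
noncomputable def parR : QRS := algebraMap (MvPolynomial (Fin 2) ℚ) QRS (MvPolynomial.X 0)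

/-- The indeterminate `s` of `ℚ(r, s)`. -/
noncomputable def parS : QRS := algebraMap (MvPolynomial (Fin 2) ℚ) QRS (MvPolynomial.X 1)

/-- The integer `(ε_k, α_i)` for `1 ≤ k ≤ n` and `0 ≤ i ≤ n - 1`, where `ε_1, …, ε_n` are
orthonormal and orthogonal to `δ`, `α_i = ε_i - ε_{i+1}` for `i ≥ 1`, and
`α_0 = δ - (ε_1 - ε_n)`. -/
def epsAlpha (n k i : ℕ) : ℤ :=
  if i = 0 then (if k = n then 1 else 0) - (if k = 1 then 1 else 0)
  else (if k = i then 1 else 0) - (if k = i + 1 then 1 else 0)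

/-- The entry `a_{ij} = (α_i, α_j)` of the generalized Cartan matrix of affine `sl_n`, `n > 2`. -/
def cartan (n : ℕ) (i j : Fin n) : ℤ :=
  ∑ k ∈ Finset.Icc 1 n, epsAlpha n k i * epsAlpha n k j

/-- Names of the invertible (group-like) generators:
`ω_i`, `ω'_i`, `γ^{1/2}`, `γ'^{1/2}`, `D`, `D'`. -/
inductive Toral (n : ℕ) : Type
  | omega (i : Fin n)
  | omega' (i : Fin n)
  | gammaHalf
  | gammaHalf'
  | D
  | D'

/-- Names of all generators: `e_i`, `f_i` (with `0 ≤ i ≤ n - 1`), the group-like generators `t`,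
and their inverses. -/
inductive Gen (n : ℕ) : Type
  | e (i : Fin n)
  | f (i : Fin n)
  | pos (t : Toral n)
  | neg (t : Toral n)

section Algebra

variable {K : Type*} [Field K]

/-- The scalar by which conjugation by `ω_j` acts on `e_i`:
`r^{(ε_j, α_i)} s^{(ε_{j+1}, α_i)}` for `j ≠ 0` and
`r^{-(ε_{i+1}, α_0)} s^{(ε_1, α_i)}` for `j = 0`.
Exchanging `r` and `s` gives the scalar for `ω'_j`. -/
def weight (n : ℕ) (r s : K) (j i : Fin n) : K :=
  if (j : ℕ) = 0 then r ^ (-epsAlpha n (i + 1) 0) * s ^ epsAlpha n 1 i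
  else r ^ epsAlpha n j i * s ^ epsAlpha n (j + 1) i

variable (K) in
/-- The generator `e_i` of the free algebra. -/
abbrev fe {n : ℕ} (i : Fin n) : FreeAlgebra K (Gen n) := FreeAlgebra.ι K (Gen.e i)

variable (K) in
/-- The generator `f_i` of the free algebra. -/
abbrev ff {n : ℕ} (i : Fin n) : FreeAlgebra K (Gen n) := FreeAlgebra.ι K (Gen.f i)

variable (K) in
/-- The group-like generator `t` of the free algebra. -/
abbrev ft {n : ℕ} (t : Toral n) : FreeAlgebra K (Gen n) := FreeAlgebra.ι K (Gen.pos t)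

variable (K) in
/-- The generator of the free algebra that becomes the inverse of `t`. -/
abbrev ftInv {n : ℕ} (t : Toral n) : FreeAlgebra K (Gen n) := FreeAlgebra.ι K (Gen.neg t)

/-- The defining relations of `U_{r,s}` of affine `sl_n`. Indices are taken in `{0, …, n - 1}`;
in the Serre relations the successor of `n - 1` is `0`. -/
inductive Rel (n : ℕ) (r s : K) : FreeAlgebra K (Gen n) → FreeAlgebra K (Gen n) → Prop
  -- invertibility and commutativity of the group-like generators
  | mul_inv (t : Toral n) : Rel n r s (ft K t * ftInv K t) 1
  | inv_mul (t : Toral n) : Rel n r s (ftInv K t * ft K t) 1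
  | toral_comm (t u : Toral n) : Rel n r s (ft K t * ft K u) (ft K u * ft K t)
  -- `γ^{1/2}` and `γ'^{1/2}` are central
  | gamma_central (x : Gen n) :
      Rel n r s (ft K .gammaHalf * FreeAlgebra.ι K x) (FreeAlgebra.ι K x * ft K .gammaHalf)
  | gamma'_central (x : Gen n) :
      Rel n r s (ft K .gammaHalf' * FreeAlgebra.ι K x) (FreeAlgebra.ι K x * ft K .gammaHalf')
  -- `γ = ω_δ = ω_0 ω_1 ⋯ ω_{n-1}`, `γ' = ω'_δ`, and `γ γ' = r s`
  | gamma_eq :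
      Rel n r s (ft K .gammaHalf ^ 2) (List.ofFn fun i : Fin n => ft K (.omega i)).prod
  | gamma'_eq :
      Rel n r s (ft K .gammaHalf' ^ 2) (List.ofFn fun i : Fin n => ft K (.omega' i)).prod
  | gamma_gamma' :
      Rel n r s (ft K .gammaHalf ^ 2 * ft K .gammaHalf' ^ 2)
        (algebraMap K (FreeAlgebra K (Gen n)) (r * s))
  -- action of `D` and `D'`
  | D_e (i : Fin n) : Rel n r s (ft K .D * fe K i * ftInv K .D)
      ((if (i : ℕ) = 0 then r else 1) • fe K i)
  | D_f (i : Fin n) : Rel n r s (ft K .D * ff K i * ftInv K .D)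
      ((if (i : ℕ) = 0 then r⁻¹ else 1) • ff K i)
  | D'_e (i : Fin n) : Rel n r s (ft K .D' * fe K i * ftInv K .D')
      ((if (i : ℕ) = 0 then s else 1) • fe K i)
  | D'_f (i : Fin n) : Rel n r s (ft K .D' * ff K i * ftInv K .D')
      ((if (i : ℕ) = 0 then s⁻¹ else 1) • ff K i)
  -- action of `ω_j` and `ω'_j`
  | omega_e (j i : Fin n) : Rel n r s (ft K (.omega j) * fe K i * ftInv K (.omega j))
      (weight n r s j i • fe K i)
  | omega_f (j i : Fin n) : Rel n r s (ft K (.omega j) * ff K i * ftInv K (.omega j))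
      ((weight n r s j i)⁻¹ • ff K i)
  | omega'_e (j i : Fin n) : Rel n r s (ft K (.omega' j) * fe K i * ftInv K (.omega' j))
      (weight n s r j i • fe K i)
  | omega'_f (j i : Fin n) : Rel n r s (ft K (.omega' j) * ff K i * ftInv K (.omega' j))
      ((weight n s r j i)⁻¹ • ff K i)
  -- the commutators `[e_i, f_j]`
  | e_f (i j : Fin n) : Rel n r s (fe K i * ff K j - ff K j * fe K i)
      ((if i = j then 1 / (r - s) else 0) • (ft K (.omega i) - ft K (.omega' i)))
  -- `[e_i, e_j] = 0 = [f_i, f_j]` when `a_{ij} = 0`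
  | e_comm (i j : Fin n) (h : cartan n i j = 0) : Rel n r s (fe K i * fe K j) (fe K j * fe K i)
  | f_comm (i j : Fin n) (h : cartan n i j = 0) : Rel n r s (ff K i * ff K j) (ff K j * ff K i)
  -- the `(r,s)`-Serre relations for `j = i + 1` modulo `n`
  | serre_e₁ (i j : Fin n) (h : (j : ℕ) = ((i : ℕ) + 1) % n) : Rel n r s
      (fe K i ^ 2 * fe K j - (r + s) • (fe K i * fe K j * fe K i)
        + (r * s) • (fe K j * fe K i ^ 2)) 0
  | serre_e₂ (i j : Fin n) (h : (j : ℕ) = ((i : ℕ) + 1) % n) : Rel n r s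
      (fe K i * fe K j ^ 2 - (r + s) • (fe K j * fe K i * fe K j)
        + (r * s) • (fe K j ^ 2 * fe K i)) 0
  | serre_f₁ (i j : Fin n) (h : (j : ℕ) = ((i : ℕ) + 1) % n) : Rel n r s
      (ff K i ^ 2 * ff K j - (r⁻¹ + s⁻¹) • (ff K i * ff K j * ff K i)
        + (r⁻¹ * s⁻¹) • (ff K j * ff K i ^ 2)) 0
  | serre_f₂ (i j : Fin n) (h : (j : ℕ) = ((i : ℕ) + 1) % n) : Rel n r s
      (ff K i * ff K j ^ 2 - (r⁻¹ + s⁻¹) • (ff K j * ff K i * ff K j)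
        + (r⁻¹ * s⁻¹) • (ff K j ^ 2 * ff K i)) 0

/-- The two-parameter quantum affine algebra `U_{r,s}` of affine `sl_n`: the unital associative
`K`-algebra presented by the generators `Gen n` and the relations `Rel n r s`. -/
abbrev QuantumAffine (n : ℕ) (r s : K) : Type _ := RingQuot (Rel n r s)

/-- The class of a generator in `U_{r,s}`. -/
def gen (n : ℕ) (r s : K) (x : Gen n) : QuantumAffine n r s :=
  RingQuot.mkAlgHom K (Rel n r s) (FreeAlgebra.ι K x)

/-- The subalgebra `U_{r,s}(n̂)` generated by the `e_i`, `0 ≤ i ≤ n - 1`. -/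
def nilPos (n : ℕ) (r s : K) : Subalgebra K (QuantumAffine n r s) :=
  Algebra.adjoin K (Set.range fun i : Fin n => gen n r s (.e i))

/-- The subalgebra `U_{r,s}(n̂⁻)` generated by the `f_i`, `0 ≤ i ≤ n - 1`. -/
def nilNeg (n : ℕ) (r s : K) : Subalgebra K (QuantumAffine n r s) :=
  Algebra.adjoin K (Set.range fun i : Fin n => gen n r s (.f i))

/-- The toral subalgebra `U⁰` generated by `ω_i^{±1}`, `ω'_i^{±1}`, `γ^{±1/2}`, `γ'^{±1/2}`,
`D^{±1}`, `D'^{±1}`. -/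
def toral (n : ℕ) (r s : K) : Subalgebra K (QuantumAffine n r s) :=
  Algebra.adjoin K ((Set.range fun t : Toral n => gen n r s (.pos t)) ∪
    Set.range fun t : Toral n => gen n r s (.neg t))

end Algebra

end TwoParamAffine

/-! Surjectivity of multiplication is the easy half: the commutation relations move every `f` to the
left and every `e` to the right. Independence requires a module in which no product of the three
parts can collapse. Present three algebras by their own relations only: `SerreAlg` with parameters
`r⁻¹, s⁻¹` for the `f`, `ToralAlg` for the group-like elements, and `SerreAlg` with parameters `r,
s` for the `e`. On the tensor product of these three spaces one constructs by hand an action of the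
whole algebra that imitates left multiplication: first the nonnegative part acts on toral ⊗ positive
(`Borel.isBorel`), then the whole algebra acts on the induced module (`Induced.isAffine`).

Two points carry the construction. First, the weights of the simple roots against a fixed one
multiply to `1` (`prod_weight`), so the relations expressing `γ` and `γ'` as products survive
rescaling. Secondly, `[e_i, ·]` must descend to the negative part, and the operators `e_i` must
satisfy the Serre relations. Both follow from one computation (`isSerreDeriv_of_skew`): a derivation
sending one generator to a skew-commuting element with the right weights, and the other generators
to zero, kills the Serre relators. Hence the relators in the operators `e_i` commute with every
`f_k`. They vanish on the generating subspace `1 ⊗ B`, so they are zero (`eq_zero_of_commute_F`).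

The orbit map of `1 ⊗ 1 ⊗ 1` sends a product `y h x` to `y ⊗ h ⊗ x` (`orbit_mul`). Conversely,
multiplication intertwines the action with left multiplication (`mulInduced_act`), so it sends the
orbit of `u` back to `u` (`mulInduced_orbit`). The presented algebras map onto the three
subalgebras, which transfers the result to them. Only `n > 2` and the nonvanishing of the two
parameters are needed. -/

namespace TwoParamAffine

/-! ### Weights of the simple roots in affine type `A`. -/

section Weights

variable {K : Type*} [Field K] {n : ℕ} {p q : K}

lemma succ_mod_eq (i : Fin n) : ((i : ℕ) + 1) % n = if (i : ℕ) + 1 = n then 0 else (i : ℕ) + 1 := by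
  split_ifs with h
  · simp [h]
  · exact Nat.mod_eq_of_lt (by omega)

lemma weight_self (hn : 2 < n) (hp : p ≠ 0) (hq : q ≠ 0) (i : Fin n) :
    weight n p q i i = p / q := by
  have := i.2
  unfold weight epsAlpha
  by_cases h : (i : ℕ) = 0
  · rw [if_pos h]
    simp [h, show ¬ 1 = n by omega]
    field_simp
  · simp [h]
    field_simp

lemma weight_succ (hn : 2 < n) (i j : Fin n) (h : (j : ℕ) = ((i : ℕ) + 1) % n) :
    weight n p q i j = q := by
  have := i.2
  rw [succ_mod_eq] at h
  unfold weight epsAlpha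
  by_cases h0 : (i : ℕ) = 0
  · have : (j : ℕ) = 1 := by rw [h, if_neg (by omega)]; omega
    simp [h0, this, show ¬ 2 = n by omega]
  · by_cases h1 : (i : ℕ) + 1 = n
    · simp [h0, h1, h, show ¬ (i : ℕ) = n by omega, show ¬ (i : ℕ) = 1 by omega,
        show ¬ n = 1 by omega]
    · simp [h0, h, h1, show ¬ (i : ℕ) = i + 1 + 1 by omega]

lemma weight_pred (hn : 2 < n) (i j : Fin n) (h : (j : ℕ) = ((i : ℕ) + 1) % n) :
    weight n p q j i = p⁻¹ := by
  have := i.2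
  rw [succ_mod_eq] at h
  unfold weight epsAlpha
  by_cases h0 : (i : ℕ) = 0
  · have : (j : ℕ) = 1 := by rw [h, if_neg (by omega)]; omega
    simp [h0, this, show ¬ 2 = n by omega, show ¬ 1 = n by omega]
  · by_cases h1 : (i : ℕ) + 1 = n
    · simp [h0, h1, h, show ¬ 1 = (i : ℕ) by omega, show ¬ n = 1 by omega,
        show ¬ 1 = n by omega]
    · simp [h0, h, h1, show ¬ (i : ℕ) + 1 + 1 = i by omega]

lemma weight_eq_one (hn : 2 < n) (i j : Fin n) (hij : i ≠ j)
    (h₁ : (j : ℕ) ≠ ((i : ℕ) + 1) % n) (h₂ : (i : ℕ) ≠ ((j : ℕ) + 1) % n) :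
    weight n p q i j = 1 := by
  have hi := i.2
  have hj := j.2
  have hij' : (i : ℕ) ≠ j := fun h => hij (Fin.ext h)
  rw [succ_mod_eq] at h₁ h₂
  have e (a : K) {z : ℤ} (hz : z = 0) : a ^ z = 1 := by rw [hz, zpow_zero]
  unfold weight epsAlpha
  split_ifs at h₁ h₂ ⊢ <;> first | omega | (rw [e _ (by omega), e _ (by omega), one_mul])

lemma cartan_self_ne (hn : 2 < n) (i : Fin n) : cartan n i i ≠ 0 := by
  have hi := i.2
  intro h
  unfold cartan at h
  rw [Finset.sum_eq_zero_iff_of_nonneg (fun k _ => mul_self_nonneg _)] at h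
  by_cases h0 : (i : ℕ) = 0
  · have := h n (by simp; omega)
    simp [epsAlpha, h0, show ¬ n = 1 by omega] at this
  · have := h i (by simp; omega)
    simp [epsAlpha, h0] at this

lemma cartan_succ_ne (hn : 2 < n) (i j : Fin n) (h : (j : ℕ) = ((i : ℕ) + 1) % n) :
    cartan n i j ≠ 0 := by
  have hi := i.2
  rw [succ_mod_eq] at h
  intro hc
  unfold cartan at hc
  -- For `n > 2` cyclically adjacent roots share a single `ε_k`, with opposite signs; it is `k = i +
  -- 1`, also at the wrap-around `j = 0`.
  have key : ∀ k ∈ Finset.Icc 1 n, epsAlpha n k i * epsAlpha n k j ≤ 0 := by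
    intro k hk
    rw [Finset.mem_Icc] at hk
    unfold epsAlpha
    split_ifs at h ⊢ <;> omega
  rw [Finset.sum_eq_zero_iff_of_nonpos key] at hc
  have := hc (i + 1) (by simp)
  unfold epsAlpha at this
  split_ifs at h this <;> omega

lemma cartan_comm (i j : Fin n) : cartan n i j = cartan n j i := by
  unfold cartan
  exact Finset.sum_congr rfl fun k _ => mul_comm _ _

lemma weight_of_cartan_eq_zero (hn : 2 < n) (i j : Fin n) (h : cartan n i j = 0) :
    weight n p q i j = 1 := by
  refine weight_eq_one hn i j ?_ ?_ ?_
  · rintro rfl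
    exact cartan_self_ne hn i h
  · exact fun h' => cartan_succ_ne hn i j h' h
  · exact fun h' => cartan_succ_ne hn j i h' (cartan_comm i j ▸ h)

lemma weight_inv (i j : Fin n) : weight n p⁻¹ q⁻¹ i j = (weight n p q i j)⁻¹ := by
  unfold weight
  split_ifs <;> simp only [inv_zpow', mul_inv, ← zpow_neg]

lemma weight_ne_zero (hp : p ≠ 0) (hq : q ≠ 0) (i j : Fin n) : weight n p q i j ≠ 0 := by
  unfold weight
  split_ifs <;> exact mul_ne_zero (zpow_ne_zero _ hp) (zpow_ne_zero _ hq)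

/-- The imaginary root acts trivially: this makes `γ` central. -/
lemma prod_weight (hn : 2 < n) (hp : p ≠ 0) (hq : q ≠ 0) (j : Fin n) :
    ∏ i, weight n p q i j = 1 := by
  have hj := j.2
  let a : Fin n := ⟨((j : ℕ) + 1) % n, Nat.mod_lt _ (by omega)⟩
  let b : Fin n := ⟨if (j : ℕ) = 0 then n - 1 else j - 1, by split_ifs <;> omega⟩
  have hb : (j : ℕ) = ((b : ℕ) + 1) % n := by
    rw [succ_mod_eq]; simp only [b]; split_ifs <;> omega
  have ha : (a : ℕ) = if (j : ℕ) + 1 = n then 0 else (j : ℕ) + 1 := succ_mod_eq j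
  have hbv : (b : ℕ) = if (j : ℕ) = 0 then n - 1 else j - 1 := rfl
  have haj : a ≠ j := by rw [Ne, Fin.ext_iff, ha]; split_ifs <;> omega
  have hbj : b ≠ j := by rw [Ne, Fin.ext_iff, hbv]; split_ifs <;> omega
  have hab : a ≠ b := by rw [Ne, Fin.ext_iff, ha, hbv]; split_ifs <;> omega
  -- Only `j`, its predecessor `b` and its successor `a` contribute. They are distinct because `n >
  -- 2`, and `(p / q) * q * p⁻¹ = 1`.
  have key (i : Fin n) : weight n p q i j =
      ((if i = j then p / q else 1) * (if i = b then q else 1)) * (if i = a then p⁻¹ else 1) := by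
    by_cases h1 : i = j
    · subst h1; rw [weight_self hn hp hq]; simp [hbj.symm, haj.symm]
    by_cases h2 : i = b
    · subst h2; rw [weight_succ hn _ _ hb]; simp [hbj, hab.symm]
    by_cases h3 : i = a
    · subst h3; rw [weight_pred hn j _ rfl]; simp [haj, hab]
    rw [weight_eq_one hn i j h1 _ fun h => h3 (Fin.ext h)]
    · simp [h1, h2, h3]
    · intro h
      apply h2
      have hi := i.2
      rw [succ_mod_eq] at h
      rw [Fin.ext_iff, hbv]
      split_ifs at h ⊢ <;> omega
  simp only [key, Finset.prod_mul_distrib, Finset.prod_ite_eq', Finset.mem_univ, if_true]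
  field_simp

end Weights

/-! ### Serre relations, derivations and the algebra they present. -/

section Serre

variable {K : Type*} [Field K] {n : ℕ} {p q : K} {R : Type*} [Ring R] [Algebra K R]

/-- The family `X` satisfies the `(p, q)`-Serre relations of affine type `A`. -/
structure IsSerre (n : ℕ) (p q : K) {R : Type*} [Ring R] [Algebra K R] (X : Fin n → R) : Prop where
  comm (i j : Fin n) (h : cartan n i j = 0) : X i * X j = X j * X i
  serre₁ (i j : Fin n) (h : (j : ℕ) = ((i : ℕ) + 1) % n) :
    X i ^ 2 * X j - (p + q) • (X i * X j * X i) + (p * q) • (X j * X i ^ 2) = 0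
  serre₂ (i j : Fin n) (h : (j : ℕ) = ((i : ℕ) + 1) % n) :
    X i * X j ^ 2 - (p + q) • (X j * X i * X j) + (p * q) • (X j ^ 2 * X i) = 0

/-- The derivation with values `d` on the generators `X` kills the Serre relators. -/
structure IsSerreDeriv (n : ℕ) (p q : K) {R : Type*} [Ring R] [Algebra K R]
    (X d : Fin n → R) : Prop where
  comm (i j : Fin n) (h : cartan n i j = 0) :
    d i * X j + X i * d j - (d j * X i + X j * d i) = 0
  serre₁ (i j : Fin n) (h : (j : ℕ) = ((i : ℕ) + 1) % n) :
    (d i * X i * X j + X i * d i * X j + X i * X i * d j)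
      - (p + q) • (d i * X j * X i + X i * d j * X i + X i * X j * d i)
      + (p * q) • (d j * X i * X i + X j * d i * X i + X j * X i * d i) = 0
  serre₂ (i j : Fin n) (h : (j : ℕ) = ((i : ℕ) + 1) % n) :
    (d i * X j * X j + X i * d j * X j + X i * X j * d j)
      - (p + q) • (d j * X i * X j + X j * d i * X j + X j * X i * d j)
      + (p * q) • (d j * X j * X i + X j * d j * X i + X j * X j * d i) = 0

/-- The relators depend on the parameters only through `p + q` and `p * q`. This lets `ω` and `ω'`,
whose weights differ by exchanging the parameters, be treated alike. -/
lemma IsSerreDeriv.symm {X d : Fin n → R} (h : IsSerreDeriv n p q X d) :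
    IsSerreDeriv n q p X d where
  comm := h.comm
  serre₁ i j hij := by rw [add_comm q p, mul_comm q p]; exact h.serre₁ i j hij
  serre₂ i j hij := by rw [add_comm q p, mul_comm q p]; exact h.serre₂ i j hij

lemma IsSerreDeriv.smul_sub {X d d' : Fin n → R} (h : IsSerreDeriv n p q X d)
    (h' : IsSerreDeriv n p q X d') (c : K) :
    IsSerreDeriv n p q X fun j => c • (d j - d' j) where
  comm i j hij := by
    have e := congrArg₂ (fun x y => c • (x - y)) (h.comm i j hij) (h'.comm i j hij)
    simp only [sub_zero, smul_zero] at e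
    rw [← e]
    simp only [mul_sub, sub_mul, smul_mul_assoc, mul_smul_comm]
    module
  serre₁ i j hij := by
    have e := congrArg₂ (fun x y => c • (x - y)) (h.serre₁ i j hij) (h'.serre₁ i j hij)
    simp only [sub_zero, smul_zero] at e
    rw [← e]
    simp only [mul_sub, sub_mul, smul_mul_assoc, mul_smul_comm]
    module
  serre₂ i j hij := by
    have e := congrArg₂ (fun x y => c • (x - y)) (h.serre₂ i j hij) (h'.serre₂ i j hij)
    simp only [sub_zero, smul_zero] at e
    rw [← e]
    simp only [mul_sub, sub_mul, smul_mul_assoc, mul_smul_comm]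
    module

/-- Push `w` to the right of every monomial using its weights `p / q`, `q`, `p⁻¹` or `1`; the
coefficient of each remaining monomial then cancels. For instance, in `serre₁` with `k = i` the
coefficient of `X i * X j * w` is `p + q - (p + q)`. -/
lemma isSerreDeriv_of_skew (hn : 2 < n) (hp : p ≠ 0) (hq : q ≠ 0) {X : Fin n → R} (k : Fin n)
    {w : R} (hw : ∀ j, w * X j = weight n p q k j • (X j * w)) :
    IsSerreDeriv n p q X fun j => if j = k then w else 0 where
  comm i j hij := by
    have hne : i ≠ j := by rintro rfl; exact cartan_self_ne hn i hij
    by_cases hi : i = k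
    · subst hi
      have h := hw j
      rw [weight_of_cartan_eq_zero hn i j hij, one_smul] at h
      simp [hne.symm, h]
    · by_cases hj : j = k
      · subst hj
        have h := hw i
        rw [weight_of_cartan_eq_zero hn j i (cartan_comm i j ▸ hij), one_smul] at h
        simp [hi, h]
      · simp [hi, hj]
  serre₁ i j hij := by
    have hne : i ≠ j := by
      rintro rfl
      have := i.2
      rw [succ_mod_eq] at hij
      split_ifs at hij <;> omega
    by_cases hi : i = k
    · subst hi
      have h := hw j
      have h' := hw i
      rw [weight_self hn hp hq] at h'
      rw [weight_succ hn i j hij] at h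
      simp only [if_true, hne.symm, if_false, mul_zero, zero_mul, add_zero, zero_add, mul_assoc, h, h',
        mul_smul_comm, smul_mul_assoc, smul_smul]
      match_scalars <;> field_simp <;> ring
    · by_cases hj : j = k
      · subst hj
        have h := hw i
        rw [weight_pred hn i j hij] at h
        simp only [if_true, hi, if_false, mul_zero, zero_mul, add_zero, zero_add, mul_assoc, h,
          mul_smul_comm, smul_mul_assoc, smul_smul]
        match_scalars
        field_simp
        ring
      · simp [hi, hj]
  serre₂ i j hij := by
    have hne : i ≠ j := by
      rintro rfl
      have := i.2
      rw [succ_mod_eq] at hij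
      split_ifs at hij <;> omega
    by_cases hi : i = k
    · subst hi
      have h := hw j
      rw [weight_succ hn i j hij] at h
      simp only [if_true, hne.symm, if_false, mul_zero, zero_mul, add_zero, zero_add, mul_assoc, h,
        mul_smul_comm, smul_mul_assoc, smul_smul]
      match_scalars
      field_simp
      ring
    · by_cases hj : j = k
      · subst hj
        have h := hw i
        have h' := hw j
        rw [weight_self hn hp hq] at h'
        rw [weight_pred hn i j hij] at h
        simp only [if_true, hi, if_false, mul_zero, zero_mul, add_zero, zero_add, mul_assoc, h, h',
          mul_smul_comm, smul_mul_assoc, smul_smul]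
        match_scalars <;> field_simp <;> ring
      · simp [hi, hj]

/-- The value at the generators of the inner derivation `[·, f_k]` kills the Serre relators. -/
lemma isSerreDeriv_commutator (hn : 2 < n) (hp : p ≠ 0) (hq : q ≠ 0) {X : Fin n → R} (k : Fin n)
    {w w' : R} (c : K) (hw : ∀ j, w * X j = weight n p q k j • (X j * w))
    (hw' : ∀ j, w' * X j = weight n q p k j • (X j * w')) :
    IsSerreDeriv n p q X fun j => if j = k then c • (w - w') else 0 := by
  have h := (isSerreDeriv_of_skew hn hp hq k hw).smul_sub
    (isSerreDeriv_of_skew hn hq hp k hw').symm c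
  convert h using 2 with j
  split_ifs <;> simp

/-- A family satisfying the Serre relations can be deformed to first order along a derivation. -/
lemma IsSerre.deform {X d : Fin n → R} (h : IsSerre n p q X) (hd : IsSerreDeriv n p q X d) :
    IsSerre n p q (R := DualNumber R) fun j => TrivSqZeroExt.inl (X j) + TrivSqZeroExt.inr (d j) where
  comm i j hij := by
    ext
    · simpa using h.comm i j hij
    -- The second component of a product of dual numbers obeys the Leibniz rule, so it is exactly
    -- the expression controlled by `hd`.
    · have := hd.comm i j hij
      rw [sub_eq_zero] at this
      simp only [TrivSqZeroExt.snd_mul, TrivSqZeroExt.fst_add, TrivSqZeroExt.snd_add,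
        TrivSqZeroExt.fst_inl, TrivSqZeroExt.snd_inl, TrivSqZeroExt.fst_inr,
        TrivSqZeroExt.snd_inr, smul_eq_mul, op_smul_eq_mul, add_zero, zero_add]
      rw [add_comm, this, add_comm]
  serre₁ i j hij := by
    ext
    · simpa using h.serre₁ i j hij
    · rw [TrivSqZeroExt.snd_zero, ← hd.serre₁ i j hij]
      simp only [pow_two, TrivSqZeroExt.snd_mul, TrivSqZeroExt.fst_mul, TrivSqZeroExt.fst_add,
        TrivSqZeroExt.snd_add, TrivSqZeroExt.snd_sub, TrivSqZeroExt.snd_smul,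
        TrivSqZeroExt.fst_inl, TrivSqZeroExt.snd_inl, TrivSqZeroExt.fst_inr,
        TrivSqZeroExt.snd_inr, smul_eq_mul, op_smul_eq_mul, add_zero, zero_add,
        mul_assoc]
      simp only [mul_add]
      module
  serre₂ i j hij := by
    ext
    · simpa using h.serre₂ i j hij
    · rw [TrivSqZeroExt.snd_zero, ← hd.serre₂ i j hij]
      simp only [pow_two, TrivSqZeroExt.snd_mul, TrivSqZeroExt.fst_mul, TrivSqZeroExt.fst_add,
        TrivSqZeroExt.snd_add, TrivSqZeroExt.snd_sub, TrivSqZeroExt.snd_smul,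
        TrivSqZeroExt.fst_inl, TrivSqZeroExt.snd_inl, TrivSqZeroExt.fst_inr,
        TrivSqZeroExt.snd_inr, smul_eq_mul, op_smul_eq_mul, add_zero, zero_add,
        mul_assoc]
      simp only [mul_add]
      module

/-- If the values of `[·, F]` on the generators form a derivation killing the Serre relators, then
the Serre relators commute with `F`. -/
lemma IsSerreDeriv.commute {X d : Fin n → R} (hd : IsSerreDeriv n p q X d) {F : R}
    (hF : ∀ j, d j = X j * F - F * X j) :
    (∀ i j, cartan n i j = 0 → Commute (X i * X j - X j * X i) F) ∧
    (∀ i j : Fin n, (j : ℕ) = ((i : ℕ) + 1) % n → Commute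
      (X i ^ 2 * X j - (p + q) • (X i * X j * X i) + (p * q) • (X j * X i ^ 2)) F) ∧
    (∀ i j : Fin n, (j : ℕ) = ((i : ℕ) + 1) % n → Commute
      (X i * X j ^ 2 - (p + q) • (X j * X i * X j) + (p * q) • (X j ^ 2 * X i)) F) := by
  -- By the Leibniz rule for `[·, F]`, the commutator of a relator with `F` is the corresponding
  -- expression in `d`.
  refine ⟨fun i j hij => ?_, fun i j hij => ?_, fun i j hij => ?_⟩ <;>
    rw [commute_iff_eq, ← sub_eq_zero]
  · rw [← hd.comm i j hij, hF, hF]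
    noncomm_ring
  · rw [← hd.serre₁ i j hij, hF, hF]
    simp only [pow_two, mul_sub, sub_mul, add_mul, mul_add, smul_mul_assoc, mul_smul_comm,
      mul_assoc]
    module
  · rw [← hd.serre₂ i j hij, hF, hF]
    simp only [pow_two, mul_sub, sub_mul, add_mul, mul_add, smul_mul_assoc, mul_smul_comm,
      mul_assoc]
    module

/-- The Serre relations for the free algebra on `n` letters. -/
inductive SerreRel (n : ℕ) (p q : K) : FreeAlgebra K (Fin n) → FreeAlgebra K (Fin n) → Prop
  | comm (i j : Fin n) (h : cartan n i j = 0) : SerreRel n p q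
      (FreeAlgebra.ι K i * FreeAlgebra.ι K j) (FreeAlgebra.ι K j * FreeAlgebra.ι K i)
  | serre₁ (i j : Fin n) (h : (j : ℕ) = ((i : ℕ) + 1) % n) : SerreRel n p q
      (FreeAlgebra.ι K i ^ 2 * FreeAlgebra.ι K j
        - (p + q) • (FreeAlgebra.ι K i * FreeAlgebra.ι K j * FreeAlgebra.ι K i)
        + (p * q) • (FreeAlgebra.ι K j * FreeAlgebra.ι K i ^ 2)) 0
  | serre₂ (i j : Fin n) (h : (j : ℕ) = ((i : ℕ) + 1) % n) : SerreRel n p q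
      (FreeAlgebra.ι K i * FreeAlgebra.ι K j ^ 2
        - (p + q) • (FreeAlgebra.ι K j * FreeAlgebra.ι K i * FreeAlgebra.ι K j)
        + (p * q) • (FreeAlgebra.ι K j ^ 2 * FreeAlgebra.ι K i)) 0

/-- The algebra presented by the `(p, q)`-Serre relations. -/
def SerreAlg (n : ℕ) (p q : K) : Type _ := RingQuot (SerreRel n p q)

/-- The ring structure of `SerreAlg`, semireducible to keep unification from unfolding it. -/
def SerreAlg.ring (n : ℕ) (p q : K) : Ring (SerreAlg n p q) :=
  inferInstanceAs (Ring (RingQuot (SerreRel n p q)))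

instance : Ring (SerreAlg n p q) := SerreAlg.ring n p q

/-- The algebra structure of `SerreAlg`. -/
def SerreAlg.algebra (n : ℕ) (p q : K) : Algebra K (SerreAlg n p q) :=
  inferInstanceAs (Algebra K (RingQuot (SerreRel n p q)))

instance : Algebra K (SerreAlg n p q) := SerreAlg.algebra n p q

namespace SerreAlg

variable (n p q) in
/-- The quotient map onto the Serre algebra. -/
def mk : FreeAlgebra K (Fin n) →ₐ[K] SerreAlg n p q := RingQuot.mkAlgHom K (SerreRel n p q)

lemma mk_rel {a b : FreeAlgebra K (Fin n)} (h : SerreRel n p q a b) : mk n p q a = mk n p q b :=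
  RingQuot.mkAlgHom_rel K h

lemma mk_surjective : Function.Surjective (mk n p q) := RingQuot.mkAlgHom_surjective K _

/-- The generators of the Serre algebra. -/
def x (p q : K) (i : Fin n) : SerreAlg n p q := mk n p q (FreeAlgebra.ι K i)

lemma isSerre_x : IsSerre n p q (x p q) where
  comm i j h := by
    simpa [x] using mk_rel (SerreRel.comm (p := p) (q := q) i j h)
  serre₁ i j h := by
    simpa [x] using mk_rel (SerreRel.serre₁ (p := p) (q := q) i j h)
  serre₂ i j h := by
    simpa [x] using mk_rel (SerreRel.serre₂ (p := p) (q := q) i j h)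

/-- The universal property of the Serre algebra. -/
def lift {X : Fin n → R} (h : IsSerre n p q X) : SerreAlg n p q →ₐ[K] R :=
  RingQuot.liftAlgHom K ⟨FreeAlgebra.lift K X, by
    intro a b hab
    induction hab with
    | comm i j hij => simpa using h.comm i j hij
    | serre₁ i j hij => simpa using h.serre₁ i j hij
    | serre₂ i j hij => simpa using h.serre₂ i j hij⟩

@[simp] lemma lift_x {X : Fin n → R} (h : IsSerre n p q X) (i : Fin n) :
    lift h (x p q i) = X i :=
  (RingQuot.liftAlgHom_mkAlgHom_apply K _ _ _).trans (FreeAlgebra.lift_ι_apply _ _)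

@[ext high] lemma algHom_ext {f g : SerreAlg n p q →ₐ[K] R} (h : ∀ i, f (x p q i) = g (x p q i)) :
    f = g := by
  apply RingQuot.ringQuot_ext'
  ext i
  exact h i

@[elab_as_elim] lemma induction_left {C : SerreAlg n p q → Prop} (one : C 1)
    (add : ∀ y z, C y → C z → C (y + z)) (smul : ∀ (c : K) y, C y → C (c • y))
    (x_mul : ∀ i y, C y → C (x p q i * y)) (y : SerreAlg n p q) : C y := by
  -- Stating stability of `C` under left multiplication, rather than `C` itself, makes the product
  -- case a composition.
  have key : ∀ (a : FreeAlgebra K (Fin n)) (z : SerreAlg n p q), C z →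
      C (mk n p q a * z) := by
    intro a
    induction a using FreeAlgebra.induction with
    | grade0 c =>
      intro z hz
      rw [AlgHom.commutes, ← Algebra.smul_def]
      exact smul c z hz
    | grade1 i => exact fun z hz => x_mul i z hz
    | mul a b ha hb =>
      intro z hz
      rw [map_mul, mul_assoc]
      exact ha _ (hb _ hz)
    | add a b ha hb =>
      intro z hz
      rw [map_add, add_mul]
      exact add _ _ (ha _ hz) (hb _ hz)
  obtain ⟨a, rfl⟩ := mk_surjective y
  simpa using key a 1 one

lemma adjoin_range_x : Algebra.adjoin K (Set.range (x (n := n) p q)) = ⊤ := by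
  refine top_unique fun y _ => ?_
  induction y using induction_left with
  | one => exact one_mem _
  | add y z hy hz => exact add_mem (hy trivial) (hz trivial)
  | smul c y hy => exact Subalgebra.smul_mem _ (hy trivial) c
  | x_mul i y hy => exact mul_mem (Algebra.subset_adjoin ⟨i, rfl⟩) (hy trivial)

end SerreAlg

/-- Each relator is homogeneous in every generator separately. -/
lemma IsSerre.scale {X : Fin n → R} (h : IsSerre n p q X) (c : Fin n → K) :
    IsSerre n p q fun i => c i • X i where
  comm i j hij := by
    simp only [smul_mul_smul_comm, h.comm i j hij, mul_comm (c i)]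
  serre₁ i j hij := by
    have := congrArg ((c i * c i * c j) • ·) (h.serre₁ i j hij)
    simp only [smul_zero] at this
    rw [← this]
    simp only [pow_two, smul_mul_assoc, mul_smul_comm, mul_assoc]
    module
  serre₂ i j hij := by
    have := congrArg ((c i * c j * c j) • ·) (h.serre₂ i j hij)
    simp only [smul_zero] at this
    rw [← this]
    simp only [pow_two, smul_mul_assoc, mul_smul_comm, mul_assoc]
    module

namespace SerreAlg

/-- The endomorphism of the Serre algebra rescaling the generators. -/
def scale (p q : K) (c : Fin n → K) : SerreAlg n p q →ₐ[K] SerreAlg n p q :=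
  lift (isSerre_x.scale c)

@[simp] lemma scale_x (c : Fin n → K) (i : Fin n) : scale p q c (x p q i) = c i • x p q i := by
  simp [scale]

end SerreAlg

end Serre

/-! ### The toral algebra and the universal property of the full algebra. -/

section Toral

variable {K : Type*} [Field K] {n : ℕ} {r s : K} {R : Type*} [Ring R] [Algebra K R]

/-- The relations between the group-like elements `P t` and their inverses `N t`. -/
structure IsToral (n : ℕ) (r s : K) {R : Type*} [Ring R] [Algebra K R] (P N : Toral n → R) :
    Prop where
  mul_inv (t : Toral n) : P t * N t = 1
  inv_mul (t : Toral n) : N t * P t = 1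
  comm (t u : Toral n) : P t * P u = P u * P t
  gamma_eq : P .gammaHalf ^ 2 = (List.ofFn fun i : Fin n => P (.omega i)).prod
  gamma'_eq : P .gammaHalf' ^ 2 = (List.ofFn fun i : Fin n => P (.omega' i)).prod
  gamma_gamma' : P .gammaHalf ^ 2 * P .gammaHalf' ^ 2 = algebraMap K R (r * s)

/-- The relations between group-like elements, in the free algebra. -/
inductive ToralRel (n : ℕ) (r s : K) :
    FreeAlgebra K (Toral n ⊕ Toral n) → FreeAlgebra K (Toral n ⊕ Toral n) → Prop
  | mul_inv (t : Toral n) : ToralRel n r s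
      (FreeAlgebra.ι K (.inl t) * FreeAlgebra.ι K (.inr t)) 1
  | inv_mul (t : Toral n) : ToralRel n r s
      (FreeAlgebra.ι K (.inr t) * FreeAlgebra.ι K (.inl t)) 1
  | comm (t u : Toral n) : ToralRel n r s
      (FreeAlgebra.ι K (.inl t) * FreeAlgebra.ι K (.inl u))
      (FreeAlgebra.ι K (.inl u) * FreeAlgebra.ι K (.inl t))
  | gamma_eq : ToralRel n r s (FreeAlgebra.ι K (.inl .gammaHalf) ^ 2)
      (List.ofFn fun i : Fin n => FreeAlgebra.ι K (.inl (.omega i))).prod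
  | gamma'_eq : ToralRel n r s (FreeAlgebra.ι K (.inl .gammaHalf') ^ 2)
      (List.ofFn fun i : Fin n => FreeAlgebra.ι K (.inl (.omega' i))).prod
  | gamma_gamma' : ToralRel n r s
      (FreeAlgebra.ι K (.inl .gammaHalf) ^ 2 * FreeAlgebra.ι K (.inl .gammaHalf') ^ 2)
      (algebraMap K _ (r * s))

/-- The commutative algebra presented by the relations between the group-like elements. -/
def ToralAlg (n : ℕ) (r s : K) : Type _ := RingQuot (ToralRel n r s)

/-- The ring structure of `ToralAlg`, semireducible to keep unification from unfolding it. -/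
def ToralAlg.ring (n : ℕ) (r s : K) : Ring (ToralAlg n r s) :=
  inferInstanceAs (Ring (RingQuot (ToralRel n r s)))

instance : Ring (ToralAlg n r s) := ToralAlg.ring n r s

/-- The algebra structure of `ToralAlg`. -/
def ToralAlg.algebra (n : ℕ) (r s : K) : Algebra K (ToralAlg n r s) :=
  inferInstanceAs (Algebra K (RingQuot (ToralRel n r s)))

instance : Algebra K (ToralAlg n r s) := ToralAlg.algebra n r s

namespace ToralAlg

variable (n r s) in
/-- The quotient map onto `ToralAlg`. -/
def mk : FreeAlgebra K (Toral n ⊕ Toral n) →ₐ[K] ToralAlg n r s :=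
  RingQuot.mkAlgHom K (ToralRel n r s)

lemma mk_rel {a b : FreeAlgebra K (Toral n ⊕ Toral n)} (h : ToralRel n r s a b) :
    mk n r s a = mk n r s b :=
  RingQuot.mkAlgHom_rel K h

lemma mk_surjective : Function.Surjective (mk n r s) := RingQuot.mkAlgHom_surjective K _

/-- The group-like generators. -/
def pos (r s : K) (t : Toral n) : ToralAlg n r s :=
  mk n r s (FreeAlgebra.ι K (.inl t))

/-- The inverses of the group-like generators. -/
def neg (r s : K) (t : Toral n) : ToralAlg n r s :=
  mk n r s (FreeAlgebra.ι K (.inr t))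

lemma isToral : IsToral n r s (pos r s) (neg r s) where
  mul_inv t := by
    simpa [pos, neg] using mk_rel (ToralRel.mul_inv (r := r) (s := s) t)
  inv_mul t := by
    simpa [pos, neg] using mk_rel (ToralRel.inv_mul (r := r) (s := s) t)
  comm t u := by
    simpa [pos, neg] using mk_rel (ToralRel.comm (r := r) (s := s) t u)
  gamma_eq := by
    simpa [pos, neg, map_list_prod, List.map_ofFn, Function.comp_def] using
      mk_rel (ToralRel.gamma_eq (n := n) (r := r) (s := s))
  gamma'_eq := by
    simpa [pos, neg, map_list_prod, List.map_ofFn, Function.comp_def] using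
      mk_rel (ToralRel.gamma'_eq (n := n) (r := r) (s := s))
  gamma_gamma' := by
    have h := mk_rel (ToralRel.gamma_gamma' (n := n) (r := r) (s := s))
    rwa [AlgHom.commutes, map_mul, map_pow, map_pow] at h

/-- The universal property of `ToralAlg`. -/
def lift {P N : Toral n → R} (h : IsToral n r s P N) : ToralAlg n r s →ₐ[K] R :=
  RingQuot.liftAlgHom K ⟨FreeAlgebra.lift K (Sum.elim P N), by
    intro a b hab
    induction hab with
    | mul_inv t => simpa using h.mul_inv t
    | inv_mul t => simpa using h.inv_mul t
    | comm t u => simpa using h.comm t u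
    | gamma_eq => simpa [map_list_prod, List.map_ofFn, Function.comp_def] using h.gamma_eq
    | gamma'_eq => simpa [map_list_prod, List.map_ofFn, Function.comp_def] using h.gamma'_eq
    | gamma_gamma' =>
      rw [AlgHom.commutes, map_mul, map_pow, map_pow]
      simpa using h.gamma_gamma'⟩

@[simp] lemma lift_pos {P N : Toral n → R} (h : IsToral n r s P N) (t : Toral n) :
    lift h (pos r s t) = P t :=
  (RingQuot.liftAlgHom_mkAlgHom_apply K _ _ _).trans (FreeAlgebra.lift_ι_apply _ _)

@[simp] lemma lift_neg {P N : Toral n → R} (h : IsToral n r s P N) (t : Toral n) :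
    lift h (neg r s t) = N t :=
  (RingQuot.liftAlgHom_mkAlgHom_apply K _ _ _).trans (FreeAlgebra.lift_ι_apply _ _)

@[elab_as_elim] lemma induction_left {C : ToralAlg n r s → Prop} (one : C 1)
    (add : ∀ y z, C y → C z → C (y + z)) (smul : ∀ (c : K) y, C y → C (c • y))
    (pos_mul : ∀ t y, C y → C (pos r s t * y)) (neg_mul : ∀ t y, C y → C (neg r s t * y))
    (y : ToralAlg n r s) : C y := by
  have key : ∀ (a : FreeAlgebra K (Toral n ⊕ Toral n)) (z : ToralAlg n r s), C z →
      C (mk n r s a * z) := by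
    intro a
    induction a using FreeAlgebra.induction with
    | grade0 c =>
      intro z hz
      rw [AlgHom.commutes, ← Algebra.smul_def]
      exact smul c z hz
    | grade1 t =>
      intro z hz
      rcases t with t | t
      · exact pos_mul t z hz
      · exact neg_mul t z hz
    | mul a b ha hb =>
      intro z hz
      rw [map_mul, mul_assoc]
      exact ha _ (hb _ hz)
    | add a b ha hb =>
      intro z hz
      rw [map_add, add_mul]
      exact add _ _ (ha _ hz) (hb _ hz)
  obtain ⟨a, rfl⟩ := mk_surjective y
  simpa using key a 1 one

lemma adjoin_range : Algebra.adjoin K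
    (Set.range (pos (n := n) r s) ∪ Set.range (neg (n := n) r s)) = ⊤ := by
  refine top_unique fun y _ => ?_
  induction y using induction_left with
  | one => exact one_mem _
  | add y z hy hz => exact add_mem (hy trivial) (hz trivial)
  | smul c y hy => exact Subalgebra.smul_mem _ (hy trivial) c
  | pos_mul i y hy => exact mul_mem (Algebra.subset_adjoin (.inl ⟨i, rfl⟩)) (hy trivial)
  | neg_mul i y hy => exact mul_mem (Algebra.subset_adjoin (.inr ⟨i, rfl⟩)) (hy trivial)

end ToralAlg

lemma prod_ofFn_smul {m : ℕ} (c : Fin m → K) (f : Fin m → R) :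
    (List.ofFn fun i => c i • f i).prod = (∏ i, c i) • (List.ofFn f).prod := by
  induction m with
  | zero => simp
  | succ m ih => simp [List.ofFn_succ, Fin.prod_univ_succ, ih, smul_smul, mul_comm]

/-- Twisting the group-like elements by a character. -/
lemma IsToral.scale {P N : Toral n → R} (h : IsToral n r s P N) {c : Toral n → K}
    (hc : ∀ t, c t ≠ 0) (hγ : c .gammaHalf = 1) (hγ' : c .gammaHalf' = 1)
    (hω : ∏ i, c (.omega i) = 1) (hω' : ∏ i, c (.omega' i) = 1) :
    IsToral n r s (fun t => c t • P t) (fun t => (c t)⁻¹ • N t) where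
  mul_inv t := by simp [h.mul_inv, hc]
  inv_mul t := by simp [h.inv_mul, hc]
  comm t u := by simp only [smul_mul_smul_comm, h.comm t u, mul_comm (c t)]
  gamma_eq := by rw [hγ, one_smul, h.gamma_eq, prod_ofFn_smul, hω, one_smul]
  gamma'_eq := by rw [hγ', one_smul, h.gamma'_eq, prod_ofFn_smul, hω', one_smul]
  gamma_gamma' := by rw [hγ, hγ', one_smul, one_smul, h.gamma_gamma']

/-- The scalar by which conjugation by a group-like generator acts on `e_i`. -/
def toralWeight (r s : K) : Toral n → Fin n → K
  | .omega j, i => weight n r s j i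
  | .omega' j, i => weight n s r j i
  | .gammaHalf, _ => 1
  | .gammaHalf', _ => 1
  | .D, i => if (i : ℕ) = 0 then r else 1
  | .D', i => if (i : ℕ) = 0 then s else 1

lemma toralWeight_ne_zero (hr : r ≠ 0) (hs : s ≠ 0) (t : Toral n) (i : Fin n) :
    toralWeight r s t i ≠ 0 := by
  cases t <;> simp only [toralWeight, ne_eq, one_ne_zero, not_false_eq_true]
  · exact weight_ne_zero hr hs _ _
  · exact weight_ne_zero hs hr _ _
  · split_ifs <;> simp [hr]
  · split_ifs <;> simp [hs]

/-- The twist of the toral algebra obtained by moving it past `e_i`. -/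
lemma IsToral.twist (hn : 2 < n) (hr : r ≠ 0) (hs : s ≠ 0) {P N : Toral n → R}
    (h : IsToral n r s P N) (i : Fin n) :
    IsToral n r s (fun t => (toralWeight r s t i)⁻¹ • P t)
      (fun t => (toralWeight r s t i)⁻¹⁻¹ • N t) :=
  h.scale (c := fun t => (toralWeight r s t i)⁻¹) (fun t => inv_ne_zero (toralWeight_ne_zero hr hs t i))
    (by simp [toralWeight]) (by simp [toralWeight])
    (by simp [toralWeight, prod_weight hn hr hs]) (by simp [toralWeight, prod_weight hn hs hr])

/-- The defining relations of `U_{r,s}`, with skew-commutation in place of conjugation. -/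
structure IsAffine (n : ℕ) (r s : K) {R : Type*} [Ring R] [Algebra K R]
    (E F : Fin n → R) (P N : Toral n → R) : Prop where
  toral : IsToral n r s P N
  pos_e (t : Toral n) (i : Fin n) : P t * E i = toralWeight r s t i • (E i * P t)
  pos_f (t : Toral n) (i : Fin n) : P t * F i = (toralWeight r s t i)⁻¹ • (F i * P t)
  e_f (i j : Fin n) : E i * F j - F j * E i =
    (if i = j then 1 / (r - s) else 0) • (P (.omega i) - P (.omega' i))
  serre_e : IsSerre n r s E
  serre_f : IsSerre n r⁻¹ s⁻¹ F

/-- Skew-commutation avoids the inverse element, and so is easier to verify on operators and to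
propagate through products. -/
lemma conj_eq_smul_iff {P N X : R} (h : P * N = 1) (h' : N * P = 1) (c : K) :
    P * X * N = c • X ↔ P * X = c • (X * P) := by
  constructor <;> intro e
  · rw [← smul_mul_assoc, ← e, mul_assoc, h', mul_one]
  · rw [e, smul_mul_assoc, mul_assoc, h, mul_one]

lemma IsAffine.neg_skew {P N X : R} (h : P * N = 1) (h' : N * P = 1) {c : K} (hc : c ≠ 0)
    (hX : P * X = c • (X * P)) : N * X = c⁻¹ • (X * N) := by
  have e : X * N = c • (N * X) := by
    calc X * N = N * (P * X) * N := by rw [← mul_assoc, h', one_mul]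
      _ = c • (N * X) := by rw [hX, mul_smul_comm, smul_mul_assoc, mul_assoc, mul_assoc, h, mul_one]
  rw [e, smul_smul, inv_mul_cancel₀ hc, one_smul]

/-- The universal property of `U_{r,s}`. -/
def IsAffine.lift {E F : Fin n → R} {P N : Toral n → R} (h : IsAffine n r s E F P N) :
    QuantumAffine n r s →ₐ[K] R :=
  RingQuot.liftAlgHom K ⟨FreeAlgebra.lift K fun
    | .e i => E i
    | .f i => F i
    | .pos t => P t
    | .neg t => N t, by
    have conj_e (t : Toral n) (i : Fin n) :=
      (conj_eq_smul_iff (h.toral.mul_inv t) (h.toral.inv_mul t) _).2 (h.pos_e t i)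
    have conj_f (t : Toral n) (i : Fin n) :=
      (conj_eq_smul_iff (h.toral.mul_inv t) (h.toral.inv_mul t) _).2 (h.pos_f t i)
    -- Centrality of `γ^{1/2}` and `γ'^{1/2}` is imposed against all generators, including the
    -- formal inverses.
    have comm_neg (t u : Toral n) : P t * N u = N u * P t := by
      have := IsAffine.neg_skew (h.toral.mul_inv u) (h.toral.inv_mul u) one_ne_zero
        (X := P t) (c := (1 : K)) (by rw [one_smul, h.toral.comm])
      rw [this, inv_one, one_smul]
    intro a b hab
    induction hab with
    | mul_inv t => simpa using h.toral.mul_inv t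
    | inv_mul t => simpa using h.toral.inv_mul t
    | toral_comm t u => simpa using h.toral.comm t u
    | gamma_central x =>
      rcases x with i | i | u | u
      · simpa [toralWeight] using h.pos_e .gammaHalf i
      · simpa [toralWeight] using h.pos_f .gammaHalf i
      · simpa using h.toral.comm .gammaHalf u
      · simpa using comm_neg .gammaHalf u
    | gamma'_central x =>
      rcases x with i | i | u | u
      · simpa [toralWeight] using h.pos_e .gammaHalf' i
      · simpa [toralWeight] using h.pos_f .gammaHalf' i
      · simpa using h.toral.comm .gammaHalf' u
      · simpa using comm_neg .gammaHalf' u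
    | gamma_eq => simpa [map_list_prod, List.map_ofFn, Function.comp_def] using h.toral.gamma_eq
    | gamma'_eq => simpa [map_list_prod, List.map_ofFn, Function.comp_def] using h.toral.gamma'_eq
    | gamma_gamma' =>
      rw [AlgHom.commutes, map_mul, map_pow, map_pow]
      simpa using h.toral.gamma_gamma'
    | D_e i => simpa [toralWeight, -ite_smul] using conj_e .D i
    | D_f i => simpa [toralWeight, -ite_smul, apply_ite] using conj_f .D i
    | D'_e i => simpa [toralWeight, -ite_smul] using conj_e .D' i
    | D'_f i => simpa [toralWeight, -ite_smul, apply_ite] using conj_f .D' i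
    | omega_e j i => simpa [toralWeight] using conj_e (.omega j) i
    | omega_f j i => simpa [toralWeight] using conj_f (.omega j) i
    | omega'_e j i => simpa [toralWeight] using conj_e (.omega' j) i
    | omega'_f j i => simpa [toralWeight] using conj_f (.omega' j) i
    | e_f i j => simpa [-ite_smul] using h.e_f i j
    | e_comm i j hij => simpa using h.serre_e.comm i j hij
    | f_comm i j hij => simpa using h.serre_f.comm i j hij
    | serre_e₁ i j hij => simpa using h.serre_e.serre₁ i j hij
    | serre_e₂ i j hij => simpa using h.serre_e.serre₂ i j hij
    | serre_f₁ i j hij => simpa using h.serre_f.serre₁ i j hij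
    | serre_f₂ i j hij => simpa using h.serre_f.serre₂ i j hij⟩

section

variable {E F : Fin n → R} {P N : Toral n → R} (h : IsAffine n r s E F P N)

@[simp] lemma IsAffine.lift_e (i : Fin n) : h.lift (gen n r s (.e i)) = E i := by
  simp [lift, gen]

@[simp] lemma IsAffine.lift_f (i : Fin n) : h.lift (gen n r s (.f i)) = F i := by
  simp [lift, gen]

@[simp] lemma IsAffine.lift_pos (t : Toral n) : h.lift (gen n r s (.pos t)) = P t := by
  simp [lift, gen]

@[simp] lemma IsAffine.lift_neg (t : Toral n) : h.lift (gen n r s (.neg t)) = N t := by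
  simp [lift, gen]

end

lemma isAffine_gen : IsAffine n r s (fun i => gen n r s (.e i)) (fun i => gen n r s (.f i))
    (fun t => gen n r s (.pos t)) (fun t => gen n r s (.neg t)) := by
  have rel {a b} (h : Rel n r s a b) := RingQuot.mkAlgHom_rel K h
  have mul_inv (t : Toral n) : gen n r s (.pos t) * gen n r s (.neg t) = 1 := by
    simpa [gen] using rel (.mul_inv t)
  have inv_mul (t : Toral n) : gen n r s (.neg t) * gen n r s (.pos t) = 1 := by
    simpa [gen] using rel (.inv_mul t)
  refine ⟨⟨mul_inv, inv_mul, fun t u => ?_, ?_, ?_, ?_⟩, fun t i => ?_, fun t i => ?_, fun i j => ?_,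
    ⟨fun i j hij => ?_, fun i j hij => ?_, fun i j hij => ?_⟩,
    ⟨fun i j hij => ?_, fun i j hij => ?_, fun i j hij => ?_⟩⟩
  · simpa [gen] using rel (.toral_comm t u)
  · simpa [gen, map_list_prod, List.map_ofFn, Function.comp_def] using rel .gamma_eq
  · simpa [gen, map_list_prod, List.map_ofFn, Function.comp_def] using rel .gamma'_eq
  · have h := rel .gamma_gamma'
    rwa [AlgHom.commutes, map_mul, map_pow, map_pow] at h
  · rw [← conj_eq_smul_iff (mul_inv t) (inv_mul t)]
    cases t with
    | omega j => simpa [gen, toralWeight] using rel (.omega_e j i)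
    | omega' j => simpa [gen, toralWeight] using rel (.omega'_e j i)
    | gammaHalf =>
      rw [conj_eq_smul_iff (mul_inv _) (inv_mul _)]
      simpa [gen, toralWeight] using rel (.gamma_central (.e i))
    | gammaHalf' =>
      rw [conj_eq_smul_iff (mul_inv _) (inv_mul _)]
      simpa [gen, toralWeight] using rel (.gamma'_central (.e i))
    | D => simpa [gen, toralWeight, -ite_smul] using rel (.D_e i)
    | D' => simpa [gen, toralWeight, -ite_smul] using rel (.D'_e i)
  · rw [← conj_eq_smul_iff (mul_inv t) (inv_mul t)]
    cases t with
    | omega j => simpa [gen, toralWeight] using rel (.omega_f j i)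
    | omega' j => simpa [gen, toralWeight] using rel (.omega'_f j i)
    | gammaHalf =>
      rw [conj_eq_smul_iff (mul_inv _) (inv_mul _)]
      simpa [gen, toralWeight] using rel (.gamma_central (.f i))
    | gammaHalf' =>
      rw [conj_eq_smul_iff (mul_inv _) (inv_mul _)]
      simpa [gen, toralWeight] using rel (.gamma'_central (.f i))
    | D => simpa [gen, toralWeight, -ite_smul, apply_ite] using rel (.D_f i)
    | D' => simpa [gen, toralWeight, -ite_smul, apply_ite] using rel (.D'_f i)
  · simpa [gen, -ite_smul] using rel (.e_f i j)
  · simpa [gen] using rel (.e_comm i j hij)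
  · simpa [gen] using rel (.serre_e₁ i j hij)
  · simpa [gen] using rel (.serre_e₂ i j hij)
  · simpa [gen] using rel (.f_comm i j hij)
  · simpa [gen] using rel (.serre_f₁ i j hij)
  · simpa [gen] using rel (.serre_f₂ i j hij)

end Toral

/-! ### Opaque tensor products. -/

section Tens

variable (K : Type*) [Field K] (A B : Type*) [AddCommGroup A] [Module K A] [AddCommGroup B]
  [Module K B]

/-- A copy of the tensor product `A ⊗ B` of vector spaces, with instances that unification does not
unfold. -/
def Tens : Type _ := A ⊗[K] B

namespace Tens

/-- The additive group structure of `Tens`. -/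
def addCommGroup : AddCommGroup (Tens K A B) := inferInstanceAs (AddCommGroup (A ⊗[K] B))

instance : AddCommGroup (Tens K A B) := addCommGroup K A B

/-- The vector space structure of `Tens`. -/
def module : Module K (Tens K A B) := inferInstanceAs (Module K (A ⊗[K] B))

instance : Module K (Tens K A B) := module K A B

/-- The identification of `Tens` with the tensor product. -/
def equiv : A ⊗[K] B ≃ₗ[K] Tens K A B := LinearEquiv.refl K (A ⊗[K] B)

variable {A B}

/-- The class of a pure tensor. -/
def mk : A →ₗ[K] B →ₗ[K] Tens K A B := (TensorProduct.mk K A B).compr₂ (equiv K A B).toLinearMap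

variable {K}

lemma ext {W : Type*} [AddCommMonoid W] [Module K W] {f g : Tens K A B →ₗ[K] W}
    (h : ∀ a b, f (mk K a b) = g (mk K a b)) : f = g := by
  have e : f ∘ₗ (equiv K A B).toLinearMap = g ∘ₗ (equiv K A B).toLinearMap :=
    TensorProduct.ext' h
  ext v
  obtain ⟨v, rfl⟩ := (equiv K A B).surjective v
  exact LinearMap.congr_fun e v

/-- The universal property of `Tens`. -/
def lift {W : Type*} [AddCommMonoid W] [Module K W] (f : A →ₗ[K] B →ₗ[K] W) : Tens K A B →ₗ[K] W :=
  TensorProduct.lift f ∘ₗ (equiv K A B).symm.toLinearMap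

@[simp] lemma lift_mk {W : Type*} [AddCommMonoid W] [Module K W] (f : A →ₗ[K] B →ₗ[K] W) (a : A)
    (b : B) : lift f (mk K a b) = f a b := by
  simp [lift, mk]

/-- The tensor product of two endomorphisms. -/
def map (f : Module.End K A) (g : Module.End K B) : Module.End K (Tens K A B) :=
  lift ((mk K).compl₁₂ f g)

@[simp] lemma map_mk (f : Module.End K A) (g : Module.End K B) (a : A) (b : B) :
    map f g (mk K a b) = mk K (f a) (g b) := by
  simp [map]

end Tens

end Tens

/-! ### The module induced from the nonnegative part. -/

section Induced

variable {K : Type*} [Field K] {n : ℕ} {r s : K}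

lemma IsSerre.map {p q : K} {R S : Type*} [Ring R] [Algebra K R] [Ring S] [Algebra K S]
    {X : Fin n → R} (h : IsSerre n p q X) (f : R →ₐ[K] S) : IsSerre n p q fun i => f (X i) where
  comm i j hij := by simpa using congrArg f (h.comm i j hij)
  serre₁ i j hij := by simpa using congrArg f (h.serre₁ i j hij)
  serre₂ i j hij := by simpa using congrArg f (h.serre₂ i j hij)

lemma prod_ofFn_skew {R : Type*} [Ring R] [Algebra K R] {m : ℕ} {f : Fin m → R} {c : Fin m → K}
    {x : R} (h : ∀ i, f i * x = c i • (x * f i)) :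
    (List.ofFn f).prod * x = (∏ i, c i) • (x * (List.ofFn f).prod) := by
  induction m with
  | zero => simp
  | succ m ih =>
    rw [List.ofFn_succ, List.prod_cons, Fin.prod_univ_succ, mul_assoc, ih fun i => h i.succ,
      mul_smul_comm, ← mul_assoc, h, smul_mul_assoc, smul_smul, mul_comm (c 0), mul_assoc]

lemma prod_ofFn_apply {V B : Type*} [AddCommGroup V] [Module K V] [AddCommGroup B] [Module K B]
    {m : ℕ} {f : Fin m → Module.End K V} {g : Fin m → Module.End K B} {ι : B → V}
    (h : ∀ i b, f i (ι b) = ι (g i b)) (b : B) :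
    (List.ofFn f).prod (ι b) = ι ((List.ofFn g).prod b) := by
  induction m with
  | zero => simp
  | succ m ih => simp [List.ofFn_succ, h, ih fun i => h i.succ]

variable {B : Type*} [AddCommGroup B] [Module K B] {E : Fin n → Module.End K B}
  {P N : Toral n → Module.End K B}

/-- A representation of the nonnegative part of `U_{r,s}`. -/
structure IsBorel (n : ℕ) (r s : K) {B : Type*} [AddCommGroup B] [Module K B]
    (E : Fin n → Module.End K B) (P N : Toral n → Module.End K B) : Prop where
  toral : IsToral n r s P N
  pos_e (t : Toral n) (i : Fin n) : P t * E i = toralWeight r s t i • (E i * P t)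
  serre_e : IsSerre n r s E

variable (n r s B) in
/-- The space underlying the module induced from a representation of the nonnegative part. -/
abbrev Induced : Type _ := Tens K (SerreAlg n r⁻¹ s⁻¹) B

namespace Induced

variable (n r s B) in
/-- Left multiplication by the negative part. -/
def mulL : SerreAlg n r⁻¹ s⁻¹ →ₐ[K] Module.End K (Induced n r s B) where
  toFun a := Tens.map (LinearMap.mulLeft K a) LinearMap.id
  map_one' := Tens.ext fun _ _ => by simp
  map_mul' _ _ := Tens.ext fun _ _ => by simp
  map_zero' := Tens.ext fun _ _ => by simp
  map_add' _ _ := Tens.ext fun _ _ => by simp [add_mul]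
  commutes' c := Tens.ext fun _ _ => by simp [Algebra.algebraMap_eq_smul_one]

@[simp] lemma mulL_tmul (a y : SerreAlg n r⁻¹ s⁻¹) (b : B) :
    mulL n r s B a (Tens.mk K y b) = Tens.mk K (a * y) b := by
  simp [mulL]

variable (r s B) in
/-- The action of `f_j`. -/
abbrev F (j : Fin n) : Module.End K (Induced n r s B) := mulL n r s B (SerreAlg.x r⁻¹ s⁻¹ j)

lemma isSerre_F : IsSerre n r⁻¹ s⁻¹ (F r s B) := SerreAlg.isSerre_x.map _

/-- The subspace `1 ⊗ B` generates the induced module under the `f_j`. Operator identities are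
therefore checked there and then carried through each `f_j`. -/
lemma ext_of_F {W : Type*} [AddCommMonoid W] [Module K W] {f g : Induced n r s B →ₗ[K] W}
    (one : ∀ b : B, f (Tens.mk K 1 b) = g (Tens.mk K 1 b))
    (step : ∀ j v, f v = g v → f (F r s B j v) = g (F r s B j v)) : f = g := by
  refine Tens.ext fun y b => ?_
  induction y using SerreAlg.induction_left with
  | one => exact one b
  | add y z hy hz => simp only [map_add, LinearMap.add_apply, hy, hz]
  | smul c y hy => simp only [map_smul, LinearMap.smul_apply, hy]
  | x_mul j y hy => simpa using step j _ hy

/-- The action of a group-like generator, from its action on `B`. -/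
def diag (T : Module.End K B) (c : Fin n → K) : Module.End K (Induced n r s B) :=
  Tens.map (SerreAlg.scale r⁻¹ s⁻¹ c).toLinearMap T

@[simp] lemma diag_one_tmul (T : Module.End K B) (c : Fin n → K) (b : B) :
    diag (r := r) (s := s) T c (Tens.mk K 1 b) = Tens.mk K 1 (T b) := by
  simp [diag]

lemma diag_mul_F (T : Module.End K B) (c : Fin n → K) (j : Fin n) :
    diag T c * F r s B j = c j • (F r s B j * diag T c) := by
  refine Tens.ext fun y b => ?_
  simp [diag]

lemma diag_F (T : Module.End K B) (c : Fin n → K) (j : Fin n) (v : Induced n r s B) :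
    diag T c (F r s B j v) = c j • F r s B j (diag T c v) :=
  LinearMap.congr_fun (diag_mul_F T c j) v

variable (r s) in
/-- The action of a group-like generator. -/
abbrev pos (P : Toral n → Module.End K B) (t : Toral n) : Module.End K (Induced n r s B) :=
  diag (P t) fun j => (toralWeight r s t j)⁻¹

variable (r s) in
/-- The action of the inverse of a group-like generator. -/
abbrev neg (N : Toral n → Module.End K B) (t : Toral n) : Module.End K (Induced n r s B) :=
  diag (N t) fun j => toralWeight r s t j

/-- Each relation holds on `1 ⊗ B` by hypothesis, and both of its sides pass `f_j` with the same
scalar. For the product formulas of `γ` and `γ'` this is `prod_weight`. -/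
lemma isToral (hn : 2 < n) (hr : r ≠ 0) (hs : s ≠ 0) (h : IsToral n r s P N) :
    IsToral n r s (pos r s P) (neg r s N) where
  mul_inv t := by
    refine ext_of_F (fun b => ?_) fun j v hv => ?_
    · simpa using congrArg (Tens.mk K (1 : SerreAlg n r⁻¹ s⁻¹) ·) (LinearMap.congr_fun (h.mul_inv t) b)
    · rw [Module.End.mul_apply] at hv ⊢
      rw [diag_F, map_smul, diag_F, hv, smul_smul, mul_inv_cancel₀ (toralWeight_ne_zero hr hs t j)]
      simp
  inv_mul t := by
    refine ext_of_F (fun b => ?_) fun j v hv => ?_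
    · simpa using congrArg (Tens.mk K (1 : SerreAlg n r⁻¹ s⁻¹) ·) (LinearMap.congr_fun (h.inv_mul t) b)
    · rw [Module.End.mul_apply] at hv ⊢
      rw [diag_F, map_smul, diag_F, hv, smul_smul, inv_mul_cancel₀ (toralWeight_ne_zero hr hs t j)]
      simp
  comm t u := by
    refine ext_of_F (fun b => ?_) fun j v hv => ?_
    · simpa using congrArg (Tens.mk K (1 : SerreAlg n r⁻¹ s⁻¹) ·) (LinearMap.congr_fun (h.comm t u) b)
    · rw [Module.End.mul_apply, Module.End.mul_apply] at hv ⊢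
      simp only [diag_F, map_smul, hv, smul_smul]
      rw [mul_comm]
  gamma_eq := by
    refine ext_of_F (fun b => ?_) fun j v hv => ?_
    · rw [prod_ofFn_apply (g := fun i => P (.omega i)) (ι := fun b => Tens.mk K 1 b)
        (fun i b => diag_one_tmul _ _ b), ← h.gamma_eq]
      simp [pow_two]
    · have e := LinearMap.congr_fun (prod_ofFn_skew (x := F r s B j)
        (f := fun i => pos r s P (.omega i)) (fun i => diag_mul_F _ _ j)) v
      rw [LinearMap.smul_apply, Module.End.mul_apply, Module.End.mul_apply, ← hv] at e
      rw [e]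
      simp only [Module.End.mul_apply, pow_two, diag_F, map_smul]
      rw [show toralWeight r s .gammaHalf j = 1 from rfl, show ∏ i, (toralWeight r s (.omega i) j)⁻¹ = 1 by
        simp [toralWeight, prod_weight hn hr hs]]
      simp only [inv_one, one_smul]
  gamma'_eq := by
    refine ext_of_F (fun b => ?_) fun j v hv => ?_
    · rw [prod_ofFn_apply (g := fun i => P (.omega' i)) (ι := fun b => Tens.mk K 1 b)
        (fun i b => diag_one_tmul _ _ b), ← h.gamma'_eq]
      simp [pow_two]
    · have e := LinearMap.congr_fun (prod_ofFn_skew (x := F r s B j)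
        (f := fun i => pos r s P (.omega' i)) (fun i => diag_mul_F _ _ j)) v
      rw [LinearMap.smul_apply, Module.End.mul_apply, Module.End.mul_apply, ← hv] at e
      rw [e]
      simp only [Module.End.mul_apply, pow_two, diag_F, map_smul]
      rw [show toralWeight r s .gammaHalf' j = 1 from rfl, show ∏ i, (toralWeight r s (.omega' i) j)⁻¹ = 1 by
        simp [toralWeight, prod_weight hn hs hr]]
      simp only [inv_one, one_smul]
  gamma_gamma' := by
    refine ext_of_F (fun b => ?_) fun j v hv => ?_
    · have e := congrArg (Tens.mk K (1 : SerreAlg n r⁻¹ s⁻¹) ·) (LinearMap.congr_fun h.gamma_gamma' b)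
      simp only [pow_two, Module.End.mul_apply, Module.algebraMap_end_apply, diag_one_tmul,
        map_smul] at e ⊢
      exact e
    · simp only [pow_two, Module.End.mul_apply, Module.algebraMap_end_apply, diag_F, map_smul] at hv ⊢
      rw [hv]
      simp [toralWeight]

variable (r s) in
/-- The commutator of `e_i` and `f_i`. -/
def H (P : Toral n → Module.End K B) (i : Fin n) : Module.End K (Induced n r s B) :=
  (1 / (r - s)) • (pos r s P (.omega i) - pos r s P (.omega' i))

/-- The group-like operators pass `f_j` with inverse weights, and by `weight_inv` these are the
weights for the parameters `r⁻¹, s⁻¹` of the negative part. -/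
lemma isSerreDeriv_F (hn : 2 < n) (hr : r ≠ 0) (hs : s ≠ 0) (i : Fin n) :
    IsSerreDeriv n r⁻¹ s⁻¹ (F r s B) fun j => if j = i then H r s P i else 0 :=
  isSerreDeriv_commutator hn (inv_ne_zero hr) (inv_ne_zero hs) i _
    (fun j => by rw [diag_mul_F, toralWeight, weight_inv])
    (fun j => by rw [diag_mul_F, toralWeight, weight_inv])

/-- The first-order deformation of left multiplication recording the commutator with `e_i`. -/
def deform (hn : 2 < n) (hr : r ≠ 0) (hs : s ≠ 0) (P : Toral n → Module.End K B) (i : Fin n) :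
    SerreAlg n r⁻¹ s⁻¹ →ₐ[K] DualNumber (Module.End K (Induced n r s B)) :=
  SerreAlg.lift (isSerre_F.deform (isSerreDeriv_F (P := P) hn hr hs i))

lemma deform_x (hn : 2 < n) (hr : r ≠ 0) (hs : s ≠ 0) (i j : Fin n) :
    deform hn hr hs P i (SerreAlg.x r⁻¹ s⁻¹ j) =
      TrivSqZeroExt.inl (F r s B j) + TrivSqZeroExt.inr (if j = i then H r s P i else 0) :=
  SerreAlg.lift_x _ j

lemma fst_deform (hn : 2 < n) (hr : r ≠ 0) (hs : s ≠ 0) (i : Fin n) (y : SerreAlg n r⁻¹ s⁻¹) :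
    (deform hn hr hs P i y).fst = mulL n r s B y := by
  have : (TrivSqZeroExt.fstHom K (Module.End K (Induced n r s B))
      (Module.End K (Induced n r s B))).comp (deform hn hr hs P i) = mulL n r s B := by
    refine SerreAlg.algHom_ext fun j => ?_
    rw [AlgHom.comp_apply, deform_x, TrivSqZeroExt.fstHom_apply, TrivSqZeroExt.fst_add,
      TrivSqZeroExt.fst_inl, TrivSqZeroExt.fst_inr, add_zero]
  exact DFunLike.congr_fun this y

/-- The first component of `deform` is left multiplication, so its second component is a derivation
with values in operators, playing the role of `y ↦ [e_i, y]`. -/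
lemma snd_deform_x_mul (hn : 2 < n) (hr : r ≠ 0) (hs : s ≠ 0) (i j : Fin n)
    (y : SerreAlg n r⁻¹ s⁻¹) :
    (deform hn hr hs P i (SerreAlg.x r⁻¹ s⁻¹ j * y)).snd =
      F r s B j * (deform hn hr hs P i y).snd
        + (if j = i then H r s P i else 0) * mulL n r s B y := by
  rw [map_mul, TrivSqZeroExt.snd_mul, fst_deform, fst_deform, smul_eq_mul, op_smul_eq_mul, deform_x,
    TrivSqZeroExt.snd_add, TrivSqZeroExt.snd_inl, TrivSqZeroExt.snd_inr, zero_add]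

/-- The action of `e_i`. -/
def raise (hn : 2 < n) (hr : r ≠ 0) (hs : s ≠ 0) (E : Fin n → Module.End K B)
    (P : Toral n → Module.End K B) (i : Fin n) : Module.End K (Induced n r s B) :=
  Tens.map LinearMap.id (E i) + Tens.lift
    (LinearMap.lcomp K (Induced n r s B) (Tens.mk K (1 : SerreAlg n r⁻¹ s⁻¹)) ∘ₗ
      (TrivSqZeroExt.sndHom (Module.End K (Induced n r s B))
        (Module.End K (Induced n r s B))).restrictScalars K ∘ₗ (deform hn hr hs P i).toLinearMap)

section

variable (hn : 2 < n) (hr : r ≠ 0) (hs : s ≠ 0)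

lemma raise_tmul (i : Fin n) (y : SerreAlg n r⁻¹ s⁻¹) (b : B) :
    raise hn hr hs E P i (Tens.mk K y b) = Tens.mk K y (E i b) + (deform hn hr hs P i y).snd (Tens.mk K 1 b) := by
  simp [raise]

lemma raise_one_tmul (i : Fin n) (b : B) : raise hn hr hs E P i (Tens.mk K 1 b) = Tens.mk K 1 (E i b) := by
  rw [raise_tmul, map_one (deform hn hr hs P i), TrivSqZeroExt.snd_one, LinearMap.zero_apply, add_zero]

lemma raise_mul_F (i j : Fin n) : raise hn hr hs E P i * F r s B j =
    F r s B j * raise hn hr hs E P i + if j = i then H r s P i else 0 := by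
  refine Tens.ext fun y b => ?_
  rw [LinearMap.add_apply, Module.End.mul_apply, Module.End.mul_apply, mulL_tmul, raise_tmul,
    raise_tmul, snd_deform_x_mul, map_add, mulL_tmul, LinearMap.add_apply, add_assoc,
    Module.End.mul_apply, Module.End.mul_apply, mulL_tmul, mul_one]

lemma raise_F (i j : Fin n) (v : Induced n r s B) : raise hn hr hs E P i (F r s B j v) =
    F r s B j (raise hn hr hs E P i v) + if j = i then H r s P i v else 0 := by
  have := LinearMap.congr_fun (raise_mul_F (E := E) (P := P) hn hr hs i j) v
  rw [Module.End.mul_apply] at this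
  rw [this]
  split_ifs <;> rfl

/-- Induction along the `f_j`. The correction term `H` is a combination of group-like operators, so
it commutes with `pos r s P t`; this is consistent because the weights of `e_i` and `f_i` are
mutually inverse. -/
lemma pos_mul_raise (h : IsBorel n r s E P N) (t : Toral n) (i : Fin n) :
    pos r s P t * raise hn hr hs E P i =
      toralWeight r s t i • (raise hn hr hs E P i * pos r s P t) := by
  have comm (u : Toral n) (v : Induced n r s B) :
      pos r s P t (pos r s P u v) = pos r s P u (pos r s P t v) :=
    LinearMap.congr_fun ((isToral hn hr hs h.toral).comm t u) v
  refine ext_of_F (fun b => ?_) fun j v hv => ?_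
  · have e := congrArg (Tens.mk K (1 : SerreAlg n r⁻¹ s⁻¹) ·) (LinearMap.congr_fun (h.pos_e t i) b)
    simp only [LinearMap.smul_apply, Module.End.mul_apply, raise_one_tmul, diag_one_tmul,
      map_smul] at e ⊢
    exact e
  · simp only [LinearMap.smul_apply, Module.End.mul_apply] at hv ⊢
    rw [raise_F, map_add, diag_F, hv, diag_F, map_smul, map_smul, raise_F]
    by_cases hj : j = i
    · subst hj
      have hH : pos r s P t (H r s P j v) = H r s P j (pos r s P t v) := by
        simp only [H, LinearMap.smul_apply, LinearMap.sub_apply, map_smul, map_sub, comm]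
      rw [if_pos rfl, if_pos rfl, hH, smul_add, smul_add, smul_smul, smul_smul, smul_smul,
        mul_inv_cancel₀ (toralWeight_ne_zero hr hs t j), inv_mul_cancel₀ (toralWeight_ne_zero hr hs t j),
        one_smul, one_smul]
    · rw [if_neg hj, if_neg hj, map_zero, add_zero, add_zero, smul_comm]

/-- The kernel of `S` contains `1 ⊗ B` and is stable under every `f_k`. -/
lemma eq_zero_of_commute_F {S : Module.End K (Induced n r s B)} (one : ∀ b : B, S (Tens.mk K 1 b) = 0)
    (comm : ∀ k, Commute S (F r s B k)) : S = 0 := by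
  refine ext_of_F one fun j v hv => ?_
  have := LinearMap.congr_fun (comm j).eq v
  rw [Module.End.mul_apply, Module.End.mul_apply] at this
  rw [this, hv, LinearMap.zero_apply, LinearMap.zero_apply, map_zero]

/-- The commutators `[e_j, f_k]` form a derivation that kills the Serre relators, so the relators in
the `e_j` commute with all `f_k`. On `1 ⊗ B` they reduce to the relators on `B`, which vanish. -/
lemma isSerre_raise (h : IsBorel n r s E P N) : IsSerre n r s (raise hn hr hs E P) := by
  have comm (k : Fin n) := IsSerreDeriv.commute (F := F r s B k)
    (isSerreDeriv_commutator (X := raise hn hr hs E P) hn hr hs k (1 / (r - s))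
      (fun j => pos_mul_raise hn hr hs h (.omega k) j)
      (fun j => pos_mul_raise hn hr hs h (.omega' k) j))
    (fun j => by
      rw [sub_eq_of_eq_add' (raise_mul_F hn hr hs j k)]
      by_cases hj : j = k
      · subst hj
        rw [if_pos rfl, if_pos rfl, H]
      · rw [if_neg hj, if_neg fun h => hj h.symm])
  refine ⟨fun i j hij => ?_, fun i j hij => ?_, fun i j hij => ?_⟩
  · refine sub_eq_zero.1 (eq_zero_of_commute_F (fun b => ?_) fun k => (comm k).1 i j hij)
    have e := congrArg (Tens.mk K (1 : SerreAlg n r⁻¹ s⁻¹) ·)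
      (LinearMap.congr_fun (h.serre_e.comm i j hij) b)
    simp only [Module.End.mul_apply, LinearMap.sub_apply, raise_one_tmul] at e ⊢
    rw [e, sub_self]
  · refine eq_zero_of_commute_F (fun b => ?_) fun k => (comm k).2.1 i j hij
    have e := congrArg (Tens.mk K (1 : SerreAlg n r⁻¹ s⁻¹) ·)
      (LinearMap.congr_fun (h.serre_e.serre₁ i j hij) b)
    simp only [pow_two, Module.End.mul_apply, LinearMap.sub_apply, LinearMap.add_apply,
      LinearMap.smul_apply, raise_one_tmul, map_add, map_sub,
      map_smul, LinearMap.zero_apply, map_zero] at e ⊢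
    exact e
  · refine eq_zero_of_commute_F (fun b => ?_) fun k => (comm k).2.2 i j hij
    have e := congrArg (Tens.mk K (1 : SerreAlg n r⁻¹ s⁻¹) ·)
      (LinearMap.congr_fun (h.serre_e.serre₂ i j hij) b)
    simp only [pow_two, Module.End.mul_apply, LinearMap.sub_apply, LinearMap.add_apply,
      LinearMap.smul_apply, raise_one_tmul, map_add, map_sub,
      map_smul, LinearMap.zero_apply, map_zero] at e ⊢
    exact e

/-- A representation of the nonnegative part induces one of `U_{r,s}`. -/
lemma isAffine (h : IsBorel n r s E P N) :
    IsAffine n r s (raise hn hr hs E P) (F r s B) (pos r s P) (neg r s N) where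
  toral := isToral hn hr hs h.toral
  pos_e := pos_mul_raise hn hr hs h
  pos_f t i := diag_mul_F _ _ i
  e_f i j := by
    rw [sub_eq_of_eq_add' (raise_mul_F hn hr hs i j), H]
    by_cases hj : i = j
    · subst hj
      rw [if_pos rfl, if_pos rfl]
    · rw [if_neg hj, if_neg fun h => hj h.symm, zero_smul]
  serre_e := isSerre_raise hn hr hs h
  serre_f := isSerre_F

end

end Induced

end Induced

/-! ### The nonnegative part acting on toral ⊗ positive. -/

section Borel

variable {K : Type*} [Field K] {n : ℕ} {r s : K}

lemma IsToral.map {R S : Type*} [Ring R] [Algebra K R] [Ring S] [Algebra K S] {P N : Toral n → R}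
    (h : IsToral n r s P N) (f : R →ₐ[K] S) :
    IsToral n r s (fun t => f (P t)) (fun t => f (N t)) where
  mul_inv t := by rw [← map_mul, h.mul_inv, map_one]
  inv_mul t := by rw [← map_mul, h.inv_mul, map_one]
  comm t u := by rw [← map_mul, h.comm, map_mul]
  gamma_eq := by
    rw [← map_pow, h.gamma_eq, map_list_prod, List.map_ofFn]
    rfl
  gamma'_eq := by
    rw [← map_pow, h.gamma'_eq, map_list_prod, List.map_ofFn]
    rfl
  gamma_gamma' := by rw [← map_pow, ← map_pow, ← map_mul, h.gamma_gamma', AlgHom.commutes]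

/-- The automorphism of the toral algebra describing its commutation with `e_i`. -/
def ToralAlg.twist (hn : 2 < n) (hr : r ≠ 0) (hs : s ≠ 0) (i : Fin n) :
    ToralAlg n r s →ₐ[K] ToralAlg n r s :=
  ToralAlg.lift (ToralAlg.isToral.twist hn hr hs i)

variable (n r s) in
/-- The underlying space of the nonnegative part of `U_{r,s}`. -/
abbrev Borel : Type _ := Tens K (ToralAlg n r s) (SerreAlg n r s)

namespace Borel

variable (hn : 2 < n) (hr : r ≠ 0) (hs : s ≠ 0)

lemma twist_pos (i : Fin n) (t : Toral n) : ToralAlg.twist hn hr hs i (ToralAlg.pos r s t) =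
    (toralWeight r s t i)⁻¹ • ToralAlg.pos r s t :=
  ToralAlg.lift_pos _ t

lemma twist_neg (i : Fin n) (t : Toral n) : ToralAlg.twist hn hr hs i (ToralAlg.neg r s t) =
    toralWeight r s t i • ToralAlg.neg r s t := by
  rw [ToralAlg.twist, ToralAlg.lift_neg, inv_inv]

/-- Every twist is diagonal on the group-like generators. -/
lemma twist_twist (i j : Fin n) (h : ToralAlg n r s) :
    ToralAlg.twist hn hr hs i (ToralAlg.twist hn hr hs j h) =
      ToralAlg.twist hn hr hs j (ToralAlg.twist hn hr hs i h) := by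
  induction h using ToralAlg.induction_left with
  | one => simp only [map_one]
  | add y z hy hz => simp only [map_add, hy, hz]
  | smul c y hy => simp only [map_smul, hy]
  | pos_mul t y hy =>
    simp only [map_mul, twist_pos, map_smul, hy]
    rw [smul_comm]
  | neg_mul t y hy =>
    simp only [map_mul, twist_neg, map_smul, hy]
    rw [smul_comm]

variable (n r s) in
/-- Left multiplication by the toral algebra. -/
def mulL : ToralAlg n r s →ₐ[K] Module.End K (Borel n r s) where
  toFun a := Tens.map (LinearMap.mulLeft K a) LinearMap.id
  map_one' := Tens.ext fun _ _ => by simp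
  map_mul' _ _ := Tens.ext fun _ _ => by simp
  map_zero' := Tens.ext fun _ _ => by simp
  map_add' _ _ := Tens.ext fun _ _ => by simp [add_mul]
  commutes' c := Tens.ext fun _ _ => by simp [Algebra.algebraMap_eq_smul_one]

@[simp] lemma mulL_mk (a h : ToralAlg n r s) (x : SerreAlg n r s) :
    mulL n r s a (Tens.mk K h x) = Tens.mk K (a * h) x := by
  simp [mulL]

/-- Left multiplication by `e_i`. -/
def raise (i : Fin n) : Module.End K (Borel n r s) :=
  Tens.map (ToralAlg.twist hn hr hs i).toLinearMap (LinearMap.mulLeft K (SerreAlg.x r s i))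

@[simp] lemma raise_mk (i : Fin n) (h : ToralAlg n r s) (x : SerreAlg n r s) :
    raise hn hr hs i (Tens.mk K h x) =
      Tens.mk K (ToralAlg.twist hn hr hs i h) (SerreAlg.x r s i * x) := by
  simp [raise]

/-- Because the twists commute, all monomials of a relator act on the toral factor by the same
composite twist, which leaves the Serre relator acting on the positive factor. -/
lemma isSerre_raise : IsSerre n r s (raise (n := n) hn hr hs) where
  comm i j hij := by
    refine Tens.ext fun h a => ?_
    rw [Module.End.mul_apply, Module.End.mul_apply, raise_mk, raise_mk, raise_mk, raise_mk,
      ← mul_assoc, ← mul_assoc, SerreAlg.isSerre_x.comm i j hij, twist_twist]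
  serre₁ i j hij := by
    refine Tens.ext fun h a => ?_
    have e := congrArg (fun z => Tens.mk K (ToralAlg.twist hn hr hs i (ToralAlg.twist hn hr hs i
      (ToralAlg.twist hn hr hs j h))) (z * a)) (SerreAlg.isSerre_x.serre₁ i j hij)
    simp only [pow_two, add_mul, sub_mul, smul_mul_assoc, mul_assoc, map_add, map_sub, map_smul,
      zero_mul, map_zero] at e
    simp only [pow_two, LinearMap.add_apply, LinearMap.sub_apply, LinearMap.smul_apply,
      Module.End.mul_apply, raise_mk, twist_twist hn hr hs j i, LinearMap.zero_apply]
    exact e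
  serre₂ i j hij := by
    refine Tens.ext fun h a => ?_
    have e := congrArg (fun z => Tens.mk K (ToralAlg.twist hn hr hs i (ToralAlg.twist hn hr hs j
      (ToralAlg.twist hn hr hs j h))) (z * a)) (SerreAlg.isSerre_x.serre₂ i j hij)
    simp only [pow_two, add_mul, sub_mul, smul_mul_assoc, mul_assoc, map_add, map_sub, map_smul,
      zero_mul, map_zero] at e
    simp only [pow_two, LinearMap.add_apply, LinearMap.sub_apply, LinearMap.smul_apply,
      Module.End.mul_apply, raise_mk, twist_twist hn hr hs j i, LinearMap.zero_apply]
    exact e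

lemma isBorel : IsBorel n r s (raise hn hr hs) (fun t => mulL n r s (ToralAlg.pos r s t))
    (fun t => mulL n r s (ToralAlg.neg r s t)) where
  toral := ToralAlg.isToral.map _
  pos_e t i := by
    refine Tens.ext fun h a => ?_
    simp only [Module.End.mul_apply, LinearMap.smul_apply, raise_mk, mulL_mk, map_mul, twist_pos,
      smul_mul_assoc, map_smul, smul_smul, mul_inv_cancel₀ (toralWeight_ne_zero hr hs t i),
      one_smul]
  serre_e := isSerre_raise hn hr hs

end Borel

end Borel

/-! ### The orbit map and the multiplication map are inverse to each other. -/

section Triangular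

variable {K : Type*} [Field K] {n : ℕ} {r s : K}

namespace QuantumAffine

variable (n r s) in
/-- The map from the presented negative part. -/
def ofNeg : SerreAlg n r⁻¹ s⁻¹ →ₐ[K] QuantumAffine n r s := SerreAlg.lift isAffine_gen.serre_f

variable (n r s) in
/-- The map from the presented toral part. -/
def ofToral : ToralAlg n r s →ₐ[K] QuantumAffine n r s := ToralAlg.lift isAffine_gen.toral

variable (n r s) in
/-- The map from the presented positive part. -/
def ofPos : SerreAlg n r s →ₐ[K] QuantumAffine n r s := SerreAlg.lift isAffine_gen.serre_e

lemma range_ofNeg : (ofNeg n r s).range = nilNeg n r s := by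
  rw [← Algebra.map_top, ← SerreAlg.adjoin_range_x, AlgHom.map_adjoin, ← Set.range_comp, nilNeg]
  congr 2
  ext i
  exact SerreAlg.lift_x _ i

lemma range_ofPos : (ofPos n r s).range = nilPos n r s := by
  rw [← Algebra.map_top, ← SerreAlg.adjoin_range_x, AlgHom.map_adjoin, ← Set.range_comp, nilPos]
  congr 2
  ext i
  exact SerreAlg.lift_x _ i

lemma range_ofToral : (ofToral n r s).range = toral n r s := by
  rw [← Algebra.map_top, ← ToralAlg.adjoin_range, AlgHom.map_adjoin, Set.image_union,
    ← Set.range_comp, ← Set.range_comp, toral]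
  congr 3
  · ext i
    exact ToralAlg.lift_pos _ i
  · ext i
    exact ToralAlg.lift_neg _ i

lemma exists_ofNeg (x : nilNeg n r s) : ∃ a, ofNeg n r s a = x.1 := by
  have h : x.1 ∈ (ofNeg n r s).range := by
    rw [range_ofNeg]
    exact x.2
  exact h

lemma exists_ofPos (x : nilPos n r s) : ∃ a, ofPos n r s a = x.1 := by
  have h : x.1 ∈ (ofPos n r s).range := by
    rw [range_ofPos]
    exact x.2
  exact h

lemma exists_ofToral (x : toral n r s) : ∃ a, ofToral n r s a = x.1 := by
  have h : x.1 ∈ (ofToral n r s).range := by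
    rw [range_ofToral]
    exact x.2
  exact h

lemma ofNeg_mem (a : SerreAlg n r⁻¹ s⁻¹) : ofNeg n r s a ∈ nilNeg n r s :=
  range_ofNeg (r := r) (s := s) ▸ AlgHom.mem_range_self _ a

lemma ofPos_mem (a : SerreAlg n r s) : ofPos n r s a ∈ nilPos n r s :=
  range_ofPos (r := r) (s := s) ▸ AlgHom.mem_range_self _ a

lemma ofToral_mem (a : ToralAlg n r s) : ofToral n r s a ∈ toral n r s :=
  range_ofToral (r := r) (s := s) ▸ AlgHom.mem_range_self _ a

variable (n r s) in
/-- The multiplication map from the presented nonnegative part. -/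
def mulBorel : Borel n r s →ₗ[K] QuantumAffine n r s :=
  Tens.lift ((LinearMap.mul K (QuantumAffine n r s)).compl₁₂ (ofToral n r s).toLinearMap
    (ofPos n r s).toLinearMap)

@[simp] lemma mulBorel_mk (h : ToralAlg n r s) (x : SerreAlg n r s) :
    mulBorel n r s (Tens.mk K h x) = ofToral n r s h * ofPos n r s x := by
  simp [mulBorel]

variable (n r s) in
/-- The multiplication map from the module induced from the nonnegative part. -/
def mulInduced : Induced n r s (Borel n r s) →ₗ[K] QuantumAffine n r s :=
  Tens.lift ((LinearMap.mul K (QuantumAffine n r s)).compl₁₂ (ofNeg n r s).toLinearMap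
    (mulBorel n r s))

@[simp] lemma mulInduced_mk (a : SerreAlg n r⁻¹ s⁻¹) (b : Borel n r s) :
    mulInduced n r s (Tens.mk K a b) = ofNeg n r s a * mulBorel n r s b := by
  simp [mulInduced]

lemma mulInduced_F (j : Fin n) (v : Induced n r s (Borel n r s)) :
    mulInduced n r s (Induced.F r s _ j v) = gen n r s (.f j) * mulInduced n r s v := by
  have : mulInduced n r s ∘ₗ Induced.F r s (Borel n r s) j =
      LinearMap.mulLeft K (gen n r s (.f j)) ∘ₗ mulInduced n r s := by
    refine Tens.ext fun a b => ?_
    simp [mul_assoc, ofNeg]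
  exact LinearMap.congr_fun this v

variable (hn : 2 < n) (hr : r ≠ 0) (hs : s ≠ 0)

/-- Both sides are multiplicative in `h`, so this reduces to moving `e_i` past a group-like
generator or its inverse; the inverse scalars are those built into the twist. -/
lemma e_mul_ofToral (i : Fin n) (h : ToralAlg n r s) : gen n r s (.e i) * ofToral n r s h =
    ofToral n r s (ToralAlg.twist hn hr hs i h) * gen n r s (.e i) := by
  induction h using ToralAlg.induction_left with
  | one => simp only [map_one, mul_one, one_mul]
  | add y z hy hz => simp only [map_add, mul_add, add_mul, hy, hz]
  | smul c y hy => simp only [map_smul, mul_smul_comm, smul_mul_assoc, hy]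
  | pos_mul t y hy =>
    have e : gen n r s (.e i) * gen n r s (.pos t) =
        (toralWeight r s t i)⁻¹ • (gen n r s (.pos t) * gen n r s (.e i)) := by
      rw [isAffine_gen.pos_e, smul_smul, inv_mul_cancel₀ (toralWeight_ne_zero hr hs t i), one_smul]
    rw [map_mul, map_mul, Borel.twist_pos, map_mul, map_smul, ofToral, ToralAlg.lift_pos,
      ← mul_assoc, e, smul_mul_assoc, smul_mul_assoc, smul_mul_assoc, mul_assoc, mul_assoc]
    exact congrArg (fun z => (toralWeight r s t i)⁻¹ • (gen n r s (.pos t) * z)) hy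
  | neg_mul t y hy =>
    have e : gen n r s (.e i) * gen n r s (.neg t) =
        toralWeight r s t i • (gen n r s (.neg t) * gen n r s (.e i)) := by
      rw [IsAffine.neg_skew (isAffine_gen.toral.mul_inv t) (isAffine_gen.toral.inv_mul t)
        (toralWeight_ne_zero hr hs t i) (isAffine_gen.pos_e t i), smul_smul,
        mul_inv_cancel₀ (toralWeight_ne_zero hr hs t i), one_smul]
    rw [map_mul, map_mul, Borel.twist_neg, map_mul, map_smul, ofToral, ToralAlg.lift_neg,
      ← mul_assoc, e, smul_mul_assoc, smul_mul_assoc, smul_mul_assoc, mul_assoc, mul_assoc]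
    exact congrArg (fun z => toralWeight r s t i • (gen n r s (.neg t) * z)) hy

lemma mulBorel_mulL (h : ToralAlg n r s) (b : Borel n r s) :
    mulBorel n r s (Borel.mulL n r s h b) = ofToral n r s h * mulBorel n r s b := by
  have : mulBorel n r s ∘ₗ Borel.mulL n r s h =
      LinearMap.mulLeft K (ofToral n r s h) ∘ₗ mulBorel n r s := by
    refine Tens.ext fun a b => ?_
    simp [mul_assoc]
  exact LinearMap.congr_fun this b

lemma mulBorel_raise (i : Fin n) (b : Borel n r s) :
    mulBorel n r s (Borel.raise hn hr hs i b) = gen n r s (.e i) * mulBorel n r s b := by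
  have : mulBorel n r s ∘ₗ Borel.raise hn hr hs i =
      LinearMap.mulLeft K (gen n r s (.e i)) ∘ₗ mulBorel n r s := by
    refine Tens.ext fun h x => ?_
    rw [LinearMap.comp_apply, LinearMap.comp_apply, Borel.raise_mk, mulBorel_mk, mulBorel_mk,
      map_mul, LinearMap.mulLeft_apply, ← mul_assoc, ← mul_assoc, e_mul_ofToral hn hr hs]
    congr 2
    exact SerreAlg.lift_x _ i
  exact LinearMap.congr_fun this b

/-- The group-like operators on the module induced from the nonnegative part. -/
abbrev posOp (r s : K) (t : Toral n) : Module.End K (Induced n r s (Borel n r s)) :=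
  Induced.pos r s (fun t => Borel.mulL n r s (ToralAlg.pos r s t)) t

/-- The action of `U_{r,s}` on the module induced from its nonnegative part. -/
def act : QuantumAffine n r s →ₐ[K] Module.End K (Induced n r s (Borel n r s)) :=
  (Induced.isAffine hn hr hs (Borel.isBorel hn hr hs)).lift

lemma mulInduced_pos (t : Toral n) (v : Induced n r s (Borel n r s)) :
    mulInduced n r s (posOp r s t v) = gen n r s (.pos t) * mulInduced n r s v := by
  have : mulInduced n r s ∘ₗ posOp r s t =
      LinearMap.mulLeft K (gen n r s (.pos t)) ∘ₗ mulInduced n r s := by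
    refine Induced.ext_of_F (fun b => ?_) fun j v hv => ?_
    · simp [mulBorel_mulL, ofToral]
    · simp only [LinearMap.comp_apply, LinearMap.mulLeft_apply] at hv ⊢
      rw [Induced.diag_F, map_smul, mulInduced_F, mulInduced_F, hv, ← mul_assoc, ← mul_assoc,
        isAffine_gen.pos_f, smul_mul_assoc]
  exact LinearMap.congr_fun this v

/-- On `1 ⊗ B` this is `mulBorel_raise`. Passing `f_j` adds the same commutator on both sides: `H`
in the module and the relation for `[e_i, f_j]` in the algebra. -/
lemma mulInduced_raise (i : Fin n) (v : Induced n r s (Borel n r s)) :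
    mulInduced n r s (Induced.raise hn hr hs (Borel.raise hn hr hs)
      (fun t => Borel.mulL n r s (ToralAlg.pos r s t)) i v) =
      gen n r s (.e i) * mulInduced n r s v := by
  have : mulInduced n r s ∘ₗ (Induced.raise hn hr hs (Borel.raise hn hr hs)
      (fun t => Borel.mulL n r s (ToralAlg.pos r s t)) i) =
      LinearMap.mulLeft K (gen n r s (.e i)) ∘ₗ mulInduced n r s := by
    refine Induced.ext_of_F (fun b => ?_) fun j v hv => ?_
    · simp only [LinearMap.comp_apply, LinearMap.mulLeft_apply, Induced.raise_one_tmul,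
        mulInduced_mk, mulBorel_raise, map_one, one_mul]
    · simp only [LinearMap.comp_apply, LinearMap.mulLeft_apply] at hv ⊢
      have e := isAffine_gen.e_f (r := r) (s := s) i j
      rw [sub_eq_iff_eq_add'] at e
      rw [Induced.raise_F, map_add, mulInduced_F, mulInduced_F, hv, ← mul_assoc, ← mul_assoc, e,
        add_mul]
      congr 1
      by_cases hj : i = j
      · subst hj
        rw [if_pos rfl, if_pos rfl, Induced.H, LinearMap.smul_apply, map_smul,
          LinearMap.sub_apply, map_sub, mulInduced_pos, mulInduced_pos, smul_mul_assoc,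
          sub_mul]
      · rw [if_neg hj, if_neg fun h => hj h.symm, zero_smul, zero_mul, map_zero]
  exact LinearMap.congr_fun this v

/-- Multiplication is a module map to the regular representation; it suffices to check generators.
-/
lemma mulInduced_act (u : QuantumAffine n r s) (v : Induced n r s (Borel n r s)) :
    mulInduced n r s (act hn hr hs u v) = u * mulInduced n r s v := by
  obtain ⟨a, rfl⟩ := RingQuot.mkAlgHom_surjective K (Rel n r s) u
  induction a using FreeAlgebra.induction generalizing v with
  | grade0 c =>
    rw [AlgHom.commutes, AlgHom.commutes, Module.algebraMap_end_apply, map_smul, Algebra.smul_def]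
  | grade1 x =>
    have hA := Induced.isAffine hn hr hs (Borel.isBorel hn hr hs)
    cases x with
    | e i =>
      refine Eq.trans ?_ (mulInduced_raise hn hr hs i v)
      exact congrArg _ (LinearMap.congr_fun (hA.lift_e i) v)
    | f i =>
      refine Eq.trans ?_ (mulInduced_F i v)
      exact congrArg _ (LinearMap.congr_fun (hA.lift_f i) v)
    | pos t =>
      refine Eq.trans ?_ (mulInduced_pos t v)
      exact congrArg _ (LinearMap.congr_fun (hA.lift_pos t) v)
    | neg t =>
      -- The inverse generators follow from `mulInduced_pos` applied to the image of `v` under the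
      -- inverse operator.
      refine Eq.trans (congrArg _ (LinearMap.congr_fun (hA.lift_neg t) v)) ?_
      have e := mulInduced_pos t
        (Induced.neg r s (fun t => Borel.mulL n r s (ToralAlg.neg r s t)) t v)
      have e' := LinearMap.congr_fun (hA.toral.mul_inv t) v
      rw [Module.End.mul_apply, Module.End.one_apply] at e'
      rw [e'] at e
      rw [e]
      refine Eq.trans (one_mul _).symm ?_
      rw [← isAffine_gen.toral.inv_mul t, mul_assoc]
      rfl
  | mul a b ha hb => rw [map_mul, map_mul, Module.End.mul_apply, ha, hb, mul_assoc]
  | add a b ha hb => rw [map_add, map_add, LinearMap.add_apply, map_add, ha, hb, add_mul]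

lemma act_ofNeg (a : SerreAlg n r⁻¹ s⁻¹) :
    act hn hr hs (ofNeg n r s a) = Induced.mulL n r s _ a := by
  have : (act hn hr hs).comp (ofNeg n r s) = Induced.mulL n r s _ := by
    refine SerreAlg.algHom_ext fun j => ?_
    rw [AlgHom.comp_apply, ofNeg, SerreAlg.lift_x, act, IsAffine.lift_f]
  exact DFunLike.congr_fun this a

lemma act_ofToral (h : ToralAlg n r s) (b : Borel n r s) :
    act hn hr hs (ofToral n r s h) (Tens.mk K 1 b) = Tens.mk K 1 (Borel.mulL n r s h b) := by
  induction h using ToralAlg.induction_left with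
  | one => simp only [map_one, Module.End.one_apply]
  | add y z hy hz => simp only [map_add, LinearMap.add_apply, hy, hz]
  | smul c y hy => simp only [map_smul, LinearMap.smul_apply, hy]
  | pos_mul t y hy =>
    rw [map_mul, map_mul, map_mul, Module.End.mul_apply, Module.End.mul_apply, hy, ofToral,
      ToralAlg.lift_pos, act, IsAffine.lift_pos, Induced.diag_one_tmul]
  | neg_mul t y hy =>
    rw [map_mul, map_mul, map_mul, Module.End.mul_apply, Module.End.mul_apply, hy, ofToral,
      ToralAlg.lift_neg, act, IsAffine.lift_neg, Induced.diag_one_tmul]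

lemma act_ofPos (x : SerreAlg n r s) :
    act hn hr hs (ofPos n r s x) (Tens.mk K 1 (Tens.mk K 1 1)) = Tens.mk K 1 (Tens.mk K 1 x) := by
  induction x using SerreAlg.induction_left with
  | one => simp only [map_one, Module.End.one_apply]
  | add y z hy hz => simp only [map_add, LinearMap.add_apply, hy, hz]
  | smul c y hy => simp only [map_smul, LinearMap.smul_apply, hy]
  | x_mul i y hy =>
    rw [map_mul, map_mul, Module.End.mul_apply, hy, ofPos, SerreAlg.lift_x, act, IsAffine.lift_e,
      Induced.raise_one_tmul, Borel.raise_mk, map_one (ToralAlg.twist hn hr hs i)]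

/-- The orbit map of the canonical generator of the induced module. -/
def orbit : QuantumAffine n r s →ₗ[K] Induced n r s (Borel n r s) :=
  LinearMap.applyₗ (Tens.mk K (1 : SerreAlg n r⁻¹ s⁻¹)
    (Tens.mk K (1 : ToralAlg n r s) (1 : SerreAlg n r s))) ∘ₗ (act hn hr hs).toLinearMap

/-- The three factors act in turn on `1 ⊗ 1 ⊗ 1`: the positive one fills the last slot, the toral
one then acts while the negative slot is still `1`, and the negative one acts by left
multiplication. -/
lemma orbit_mul (a : SerreAlg n r⁻¹ s⁻¹) (h : ToralAlg n r s) (x : SerreAlg n r s) :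
    orbit hn hr hs (ofNeg n r s a * ofToral n r s h * ofPos n r s x) =
      Tens.mk K a (Tens.mk K h x) := by
  change act hn hr hs _ _ = _
  rw [map_mul, map_mul, Module.End.mul_apply, Module.End.mul_apply, act_ofPos, act_ofToral,
    act_ofNeg, Borel.mulL_mk, Induced.mulL_tmul, mul_one, mul_one]

lemma mulInduced_orbit (u : QuantumAffine n r s) :
    mulInduced n r s (orbit hn hr hs u) = u := by
  change mulInduced n r s (act hn hr hs u _) = u
  rw [mulInduced_act, mulInduced_mk, mulBorel_mk, map_one, map_one, map_one, mul_one, mul_one,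
    mul_one]

variable (n r s) in
/-- The canonical map from the presented triangular decomposition to the one inside `U_{r,s}`. -/
def toParts : Induced n r s (Borel n r s) →ₗ[K] (nilNeg n r s ⊗[K] toral n r s ⊗[K] nilPos n r s) :=
  (TensorProduct.assoc K _ _ _).symm.toLinearMap ∘ₗ
    Tens.lift ((TensorProduct.mk K _ _).compl₁₂
      ((ofNeg n r s).codRestrict _ ofNeg_mem).toLinearMap
      (Tens.lift ((TensorProduct.mk K _ _).compl₁₂
        ((ofToral n r s).codRestrict _ ofToral_mem).toLinearMap
        ((ofPos n r s).codRestrict _ ofPos_mem).toLinearMap)))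

lemma toParts_mk (a : SerreAlg n r⁻¹ s⁻¹) (h : ToralAlg n r s) (x : SerreAlg n r s) :
    toParts n r s (Tens.mk K a (Tens.mk K h x)) =
      (⟨_, ofNeg_mem a⟩ : nilNeg n r s) ⊗ₜ[K] (⟨_, ofToral_mem h⟩ : toral n r s) ⊗ₜ[K]
        (⟨_, ofPos_mem x⟩ : nilPos n r s) := by
  simp only [toParts, LinearMap.comp_apply, Tens.lift_mk, LinearMap.compl₁₂_apply,
    TensorProduct.mk_apply]
  rfl

variable (n r s) in
/-- The multiplication map of the triangular decomposition. -/
def mulParts : (nilNeg n r s ⊗[K] toral n r s ⊗[K] nilPos n r s) →ₗ[K] QuantumAffine n r s :=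
  TensorProduct.lift ((LinearMap.mul K _).compl₁₂
    (TensorProduct.lift ((LinearMap.mul K _).compl₁₂ (nilNeg n r s).val.toLinearMap
      (toral n r s).val.toLinearMap)) (nilPos n r s).val.toLinearMap)

lemma mulParts_tmul (x : nilNeg n r s) (y : toral n r s) (z : nilPos n r s) :
    mulParts n r s (x ⊗ₜ y ⊗ₜ z) = x.1 * y.1 * z.1 := by
  simp [mulParts]

lemma mulParts_toParts (v : Induced n r s (Borel n r s)) :
    mulParts n r s (toParts n r s v) = mulInduced n r s v := by
  have : mulParts n r s ∘ₗ toParts n r s = mulInduced n r s := by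
    refine Tens.ext fun a b => ?_
    have : (mulParts n r s ∘ₗ toParts n r s) ∘ₗ Tens.mk K a =
        mulInduced n r s ∘ₗ Tens.mk K a := by
      refine Tens.ext fun h x => ?_
      rw [LinearMap.comp_apply, LinearMap.comp_apply, LinearMap.comp_apply, toParts_mk,
        mulParts_tmul, mulInduced_mk, mulBorel_mk, mul_assoc]
    exact LinearMap.congr_fun this b
  exact LinearMap.congr_fun this v

/-- Lifts of `x`, `y`, `z` to the presented algebras suffice; no injectivity of the maps from these
algebras enters. -/
lemma toParts_orbit_mul (x : nilNeg n r s) (y : toral n r s) (z : nilPos n r s) :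
    toParts n r s (orbit hn hr hs (x.1 * y.1 * z.1)) = x ⊗ₜ[K] y ⊗ₜ[K] z := by
  obtain ⟨x, hx⟩ := x
  obtain ⟨y, hy⟩ := y
  obtain ⟨z, hz⟩ := z
  obtain ⟨a, rfl⟩ := exists_ofNeg ⟨x, hx⟩
  obtain ⟨h, rfl⟩ := exists_ofToral ⟨y, hy⟩
  obtain ⟨c, rfl⟩ := exists_ofPos ⟨z, hz⟩
  rw [orbit_mul, toParts_mk]

/-- The triangular decomposition of `U_{r,s}` over any field, for nonzero parameters. -/
def triangular :
    QuantumAffine n r s ≃ₗ[K] (nilNeg n r s ⊗[K] toral n r s ⊗[K] nilPos n r s) :=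
  LinearEquiv.ofLinearMap (toParts n r s ∘ₗ orbit hn hr hs) (mulParts n r s)
    (by
      refine TensorProduct.ext_threefold fun x y z => ?_
      rw [LinearMap.comp_apply, mulParts_tmul]
      exact toParts_orbit_mul hn hr hs x y z)
    (by
      refine LinearMap.ext fun u => ?_
      rw [LinearMap.comp_apply, LinearMap.comp_apply, mulParts_toParts, mulInduced_orbit]
      rfl)

end QuantumAffine

end Triangular

/-! ### Specialization to the two indeterminates. -/

lemma parR_ne_zero : parR ≠ 0 :=
  (map_ne_zero_iff _ (IsFractionRing.injective _ _)).2 (MvPolynomial.X_ne_zero _)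

lemma parS_ne_zero : parS ≠ 0 :=
  (map_ne_zero_iff _ (IsFractionRing.injective _ _)).2 (MvPolynomial.X_ne_zero _)

end TwoParamAffine

/-- Triangular decomposition: multiplication identifies `U(n̂⁻) ⊗ U⁰ ⊗ U(n̂)` with the
two-parameter quantum affine algebra, as vector spaces over `ℚ(r, s)`. -/
theorem corollary2p7 (n : ℕ) (hn : 2 < n) :
    ∃ φ : TwoParamAffine.QuantumAffine n TwoParamAffine.parR TwoParamAffine.parS
        ≃ₗ[TwoParamAffine.QRS]
          (TwoParamAffine.nilNeg n TwoParamAffine.parR TwoParamAffine.parS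
            ⊗[TwoParamAffine.QRS] TwoParamAffine.toral n TwoParamAffine.parR TwoParamAffine.parS
            ⊗[TwoParamAffine.QRS] TwoParamAffine.nilPos n TwoParamAffine.parR TwoParamAffine.parS),
      ∀ (x : TwoParamAffine.nilNeg n TwoParamAffine.parR TwoParamAffine.parS)
        (y : TwoParamAffine.toral n TwoParamAffine.parR TwoParamAffine.parS)
        (z : TwoParamAffine.nilPos n TwoParamAffine.parR TwoParamAffine.parS),
        φ (x.1 * y.1 * z.1) = x ⊗ₜ[TwoParamAffine.QRS] y ⊗ₜ[TwoParamAffine.QRS] z :=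
  ⟨TwoParamAffine.QuantumAffine.triangular hn TwoParamAffine.parR_ne_zero
      TwoParamAffine.parS_ne_zero,
    TwoParamAffine.QuantumAffine.toParts_orbit_mul hn TwoParamAffine.parR_ne_zero
      TwoParamAffine.parS_ne_zero⟩
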